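/- A Boolean circuit $G$ over variables $X_1,\dots,X_n$ ($n\ge 0$) is a finite directed acyclic graph whose nodes (gates) are labeled with a constant $0$ or $1$, with a variable $X_j$, or with a connective $\wedge$, $\vee$ or $\neg$. Constant and variable gates have no incoming edges, $\neg$-gates have exactly one, and $\wedge$- and $\vee$-gates have at least two; exactly one gate, the output gate, has no outgoing edge. The value of the output gate defines a Boolean function $F_G:\{0,1\}^n\to\{0,1\}$. For a gate $g$, let $G_g$ be the circuit formed by all gates that have a (possibly empty) directed path to $g$. The circuit $G$ is deterministic if for every $\vee$-gate and any two distinct input gates $g_1,g_2$ of it, no valuation makes both $G_{g_1}$ and $G_{g_2}$ true; it is decomposable if for every $\wedge$-gate and any two distinct input gates $g_1,g_2$ of it, no variable occurs in both $G_{g_1}$ and $G_{g_2}$. For a Boolean function $F:\{0,1\}^n\to\{0,1\}$ and $T\subseteq[n]$, let $F[T]$ be the value of $F$ at the valuation that sets exactly the variables $X_j$ with $j\in T$ to $1$. The Shapley value of $X_i$ is $$\mathrm{Shap}(F,X_i)=\frac1{n!}\sum_{\Pi\in S_n}\bigl(F[\Pi^{<i}\cup\{i\}]-F[\Pi^{<i}]\bigr),$$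 where $\Pi^{<i}$ is the set of indices that come before $i$ in the permutation $\Pi$. Theorem. The problem of computing the vector $(\mathrm{Shap}(F_G,X_1),\dots,\mathrm{Shap}(F_G,X_n))$ from a given deterministic and decomposable circuit $G$ over $X_1,\dots,X_n$ is in FP: there is a deterministic (multi-stack) Turing machine that, on every such input, outputs this vector within a number of steps that is polynomial in the length of the input. Here the input consists of $n$ in unary and the list of the gates of $G$, each with its label and its row of the adjacency matrix (so its length is polynomial in $n$ plus the number of gates), and each rational number in the output is written as a fraction of integers in binary with nonzero denominator. The behavior of the machine on other inputs is arbitrary. -/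

import Mathlib

namespace ShapleyCircuits

/-! ### Boolean functions and Shapley values -/

/-- The value `F[T] ∈ {0, 1}` of the Boolean function `F` at the valuation that sets exactly the
variables in `T` to `1`. -/
def valueAt {n : ℕ} (F : (Fin n → Bool) → Bool) (T : Finset (Fin n)) : ℚ :=
  if F (fun j => decide (j ∈ T)) = true then 1 else 0

/-- The set of indices that come before `i` in the permutation `π`, where `π` is read as the
ordering `(π 0, π 1, …, π (n - 1))` of the indices. -/
def before {n : ℕ} (π : Equiv.Perm (Fin n)) (i : Fin n) : Finset (Fin n) :=
  Finset.univ.filter fun j => π.symm j < π.symm i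

/-- The Shapley value of the variable with index `i`. -/
def shap {n : ℕ} (F : (Fin n → Bool) → Bool) (i : Fin n) : ℚ :=
  1 / (n.factorial : ℚ) *
    ∑ π : Equiv.Perm (Fin n), (valueAt F (before π i ∪ {i}) - valueAt F (before π i))

/-- The vector of the Shapley values of all variables. -/
def shapVector {n : ℕ} (F : (Fin n → Bool) → Bool) : List ℚ :=
  List.ofFn (shap F)

/-! ### Boolean circuits -/

/-- The labels of gates over the variables `X_0, …, X_{n-1}`. -/
inductive Label (n : ℕ) : Type
  | const (b : Bool)
  | var (x : Fin n)
  | and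
  | or
  | not

/-- The numbers of incoming edges that a gate with a given label may have. -/
def Label.FanIn {n : ℕ} : Label n → ℕ → Prop
  | .const _, k => k = 0
  | .var _, k => k = 0
  | .and, k => 2 ≤ k
  | .or, k => 2 ≤ k
  | .not, k => k = 1

/-- A Boolean circuit over the variables `X_0, …, X_{n-1}`: a directed acyclic graph of labelled
gates, numbered in an arbitrary order, with exactly one gate that has no outgoing edge. -/
structure Circuit (n : ℕ) : Type where
  /-- the number of gates -/
  size : ℕ
  label : Fin size → Label n
  /-- `inputs g` is the set of the gates that have an edge to `g` -/
  inputs : Fin size → Finset (Fin size)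
  output : Fin size
  acyclic : WellFounded fun h g : Fin size => h ∈ inputs g
  fanIn : ∀ g, (label g).FanIn (inputs g).card
  output_iff : ∀ g, (∀ h, g ∉ inputs h) ↔ g = output

namespace Circuit

variable {n : ℕ} (C : Circuit n)

/-- The value of the gate `g` under the valuation `θ`. It depends only on the gates that have a
directed path to `g`, so it is the value of the circuit `C_g` below `g`.
(A `not` gate has exactly one input.) -/
def gateValue (θ : Fin n → Bool) : Fin C.size → Bool :=
  C.acyclic.fix fun g val =>
    match C.label g with
    | .const b => b
    | .var x => θ x
    | .and => decide (∀ h, ∀ hg : h ∈ C.inputs g, val h hg = true)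
    | .or => decide (∃ h, ∃ hg : h ∈ C.inputs g, val h hg = true)
    | .not => decide (∀ h, ∀ hg : h ∈ C.inputs g, val h hg = false)

/-- The Boolean function that the circuit represents. -/
def toFun (θ : Fin n → Bool) : Bool :=
  C.gateValue θ C.output

/-- The variables of the circuit `C_g`, which consists of the gates that have a (possibly empty)
directed path to `g`. -/
def varsBelow (g : Fin C.size) : Set (Fin n) :=
  {x | ∃ h, Relation.ReflTransGen (fun a b => a ∈ C.inputs b) h g ∧ C.label h = .var x}

/-- Distinct inputs of an `or` gate are never true together. -/
def Deterministic : Prop :=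
  ∀ g, C.label g = .or → ∀ g₁ ∈ C.inputs g, ∀ g₂ ∈ C.inputs g, g₁ ≠ g₂ →
    ¬ ∃ θ : Fin n → Bool, C.gateValue θ g₁ = true ∧ C.gateValue θ g₂ = true

/-- The circuits below distinct inputs of an `and` gate have no variable in common. -/
def Decomposable : Prop :=
  ∀ g, C.label g = .and → ∀ g₁ ∈ C.inputs g, ∀ g₂ ∈ C.inputs g, g₁ ≠ g₂ →
    Disjoint (C.varsBelow g₁) (C.varsBelow g₂)

end Circuit

/-- The class of deterministic and decomposable circuits. -/
structure DDCircuit : Type where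
  numVars : ℕ
  circuit : Circuit numVars
  deterministic : circuit.Deterministic
  decomposable : circuit.Decomposable

/-! ### Input and output strings -/

/-- The alphabet of the input strings. -/
inductive InSym : Type
  | tick
  | sep
  | bit (b : Bool)
  | const (b : Bool)
  | var
  | and
  | or
  | not
  deriving DecidableEq, Fintype

/-- A variable is written as its index in unary. -/
def Label.encode {n : ℕ} : Label n → List InSym
  | .const b => [.const b]
  | .var x => .var :: List.replicate x .tick
  | .and => [.and]
  | .or => [.or]
  | .not => [.not]

/-- A circuit is written as the number of its variables in unary, followed by one block for each
gate. The block of `g` holds the label of `g`, the row of the adjacency matrix that describes the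
inputs of `g`, and one bit that tells whether `g` is the output gate. -/
def Circuit.encode {n : ℕ} (C : Circuit n) : List InSym :=
  List.replicate n .tick ++ [.sep] ++
    (List.finRange C.size).flatMap fun g =>
      (C.label g).encode ++
        (List.finRange C.size).map (fun h => .bit (decide (h ∈ C.inputs g))) ++
        [.bit (decide (g = C.output)), .sep]

/-- The input string for a deterministic and decomposable circuit. -/
def DDCircuit.encode (G : DDCircuit) : List InSym :=
  G.circuit.encode

theorem Label.length_encode_le {n : ℕ} (l : Label n) : l.encode.length ≤ n + 1 := by
  cases l <;> simp [Label.encode]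

/-- The length of the input string is polynomial in the number of gates and variables. -/
theorem Circuit.length_encode_le {n : ℕ} (C : Circuit n) :
    C.encode.length ≤ n + 1 + C.size * (n + C.size + 3) := by
  simp only [Circuit.encode, List.length_append, List.length_replicate, List.length_flatMap,
    List.length_map, List.length_finRange, List.length_cons, List.length_nil]
  gcongr
  refine (List.sum_le_card_nsmul _ (n + C.size + 3) ?_).trans (by simp)
  intro k hk
  obtain ⟨g, -, rfl⟩ := List.mem_map.1 hk
  have := (C.label g).length_encode_le
  omega

/-- The alphabet of the output strings. -/
inductive OutSym : Type
  | bit (b : Bool)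
  | minus
  | slash
  | sep
  deriving DecidableEq, Fintype

/-- A fraction is written as its sign, numerator and denominator, both in binary (least
significant bit first). -/
def encodeFraction (q : ℤ × ℕ) : List OutSym :=
  (if q.1 < 0 then [.minus] else []) ++ q.1.natAbs.bits.map .bit ++ [.slash] ++
    q.2.bits.map .bit ++ [.sep]

/-- The output string for a vector of fractions. -/
def encodeFractions (v : List (ℤ × ℕ)) : List OutSym :=
  v.flatMap encodeFraction

/-- The vector of fractions `v` represents the vector of rational numbers `r`. -/
def Represents (v : List (ℤ × ℕ)) (r : List ℚ) : Prop :=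
  (∀ q ∈ v, q.2 ≠ 0) ∧ v.map (fun q => (q.1 : ℚ) / (q.2 : ℚ)) = r

end ShapleyCircuits

/-! Write the multilinear extension of `F` as a sum of `c_T ∏_{j ∈ T} x_j`. In a random ordering,
`i` comes last in a set `T` containing it with probability `1 / |T|`. By linearity `n! · Shap(F,
X_i)` is therefore the integer `shapNumerator`, the sum of `c_T · n! / |T|` over all `T` containing
`i` (`card_mul_card_lastOrderings`, `shapNumerator_div`).

This integer can be read off from one evaluation of the extension. Put `x_i = p^(2n)` and `x_j = p`
for `j ≠ i`, with `p = 2^width`, and multiply the value by `W(p)`, the sum of `n!/(j+1) · p^(n-1-j)`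
over `j < n`. A set `T` containing `i` contributes exponents `3n - 1 + |T| - (j+1)`, so exponent `3n
- 1` occurs exactly for `j + 1 = |T|`, where the coefficient is `c_T · n! / |T|`. Higher exponents
give multiples of `p^(3n)`. All other terms, including those of sets that omit `i`, have exponent at
most `3n - 2`, and `p` is so large that together they stay below `p^(3n-1) / 2`. Hence the number
sought is the base-`p` digit at place `3n - 1`, after rounding and up to multiples of `p`
(`exists_two_mul_abs_extension_sub_lt`). It suffices to compute modulo `p^(3n)`, on words of `3n ·
width` bits.

The circuit itself evaluates the extension: determinism turns disjunction into a sum,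
decomposability turns conjunction into a product, and negation is `1 - v` (`gateExtension_eq`). No
topological order of the gates is needed: updating all gates simultaneously reaches the correct
values after as many rounds as there are gates (`iterate_stepValue_eq`).

For the running time, the algorithm is written in a loop language whose loops run over the content
of a register fixed at loop entry. Each loop then makes at most as many iterations as the length
bound, so a polynomial bound on the register lengths yields a polynomial bound on the steps of the
compiled stack machine (`code_reachesIn`, `nonempty_tm2ComputableInPolyTime`). `exec_shapley` joins
the two halves. -/

namespace ShapleyCircuits

/-! ### A loop language on registers -/

/-- The registers of the loop language. -/
inductive Reg : Type
  | inp | nn | body | mm | len | idx | cmp | tab | ntab | cur | acc | arg | fac | tmp | carry | op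
  | res | pp | qq | wts | fct | cnt
  deriving DecidableEq

/-- There are finitely many registers. -/
instance : Fintype Reg :=
  Fintype.ofList [.inp, .nn, .body, .mm, .len, .idx, .cmp, .tab, .ntab, .cur, .acc, .arg, .fac,
    .tmp, .carry, .op, .res, .pp, .qq, .wts, .fct, .cnt] (by intro k; cases k <;> simp)

/-- The contents of the registers and of the output. -/
structure Store : Type where
  inp : List InSym
  nn : List InSym
  body : List InSym
  mm : List InSym
  len : List InSym
  idx : List InSym
  cmp : List InSym
  tab : List InSym
  ntab : List InSym
  cur : List InSym
  acc : List InSym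
  arg : List InSym
  fac : List InSym
  tmp : List InSym
  carry : List InSym
  op : List InSym
  res : List InSym
  pp : List InSym
  qq : List InSym
  wts : List InSym
  fct : List InSym
  cnt : List InSym
  out : List OutSym

namespace Store

/-- The content of a register. -/
def get (s : Store) : Reg → List InSym
  | .inp => s.inp
  | .nn => s.nn
  | .body => s.body
  | .mm => s.mm
  | .len => s.len
  | .idx => s.idx
  | .cmp => s.cmp
  | .tab => s.tab
  | .ntab => s.ntab
  | .cur => s.cur
  | .acc => s.acc
  | .arg => s.arg
  | .fac => s.fac
  | .tmp => s.tmp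
  | .carry => s.carry
  | .op => s.op
  | .res => s.res
  | .pp => s.pp
  | .qq => s.qq
  | .wts => s.wts
  | .fct => s.fct
  | .cnt => s.cnt

/-- Replaces the content of a register. -/
def set (s : Store) (k : Reg) (l : List InSym) : Store :=
  match k with
  | .inp => { s with inp := l }
  | .nn => { s with nn := l }
  | .body => { s with body := l }
  | .mm => { s with mm := l }
  | .len => { s with len := l }
  | .idx => { s with idx := l }
  | .cmp => { s with cmp := l }
  | .tab => { s with tab := l }
  | .ntab => { s with ntab := l }
  | .cur => { s with cur := l }
  | .acc => { s with acc := l }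
  | .arg => { s with arg := l }
  | .fac => { s with fac := l }
  | .tmp => { s with tmp := l }
  | .carry => { s with carry := l }
  | .op => { s with op := l }
  | .res => { s with res := l }
  | .pp => { s with pp := l }
  | .qq => { s with qq := l }
  | .wts => { s with wts := l }
  | .fct => { s with fct := l }
  | .cnt => { s with cnt := l }

/-- The store with all registers empty, apart from the input and the output. -/
def init (i : List InSym) (o : List OutSym) : Store :=
  ⟨i, [], [], [], [], [], [], [], [], [], [], [], [], [], [], [], [], [], [], [], [], [], o⟩

@[simp]
theorem get_set_self (s : Store) (k : Reg) (l : List InSym) : (s.set k l).get k = l := by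
  cases k <;> rfl

theorem get_set_of_ne (s : Store) {k k' : Reg} (h : k' ≠ k) (l : List InSym) :
    (s.set k l).get k' = s.get k' := by
  cases k <;> cases k' <;> first | rfl | exact absurd rfl h

@[simp]
theorem set_set (s : Store) (k : Reg) (l l' : List InSym) : (s.set k l).set k l' = s.set k l' := by
  cases k <;> rfl

@[simp]
theorem set_get (s : Store) (k : Reg) : s.set k (s.get k) = s := by
  cases k <;> rfl

@[simp]
theorem out_set (s : Store) (k : Reg) (l : List InSym) : (s.set k l).out = s.out := by
  cases k <;> rfl

end Store

/-- Programs of the loop language. The loop `loop rev k f` runs through the symbols that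
register `k` holds when the loop is entered, from the top of the stack to the bottom, or
in the opposite direction if `rev` is true. -/
inductive Prog : Type
  | skip
  | push (k : Reg) (a : InSym)
  | pop (k : Reg)
  | clear (k : Reg)
  | emit (o : OutSym)
  | seq (P Q : Prog)
  | case (k : Reg) (f : Option InSym → Prog)
  | loop (rev : Bool) (k : Reg) (f : InSym → Prog)

namespace Prog

infixr:60 " ;; " => Prog.seq

/-- The effect of a program, or `none` if some register that is cleared or looped over holds more
than `N` symbols. -/
def exec (N : ℕ) : Prog → Store → Option Store
  | skip, s => some s
  | push k a, s => some (s.set k (a :: s.get k))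
  | pop k, s => some (s.set k (s.get k).tail)
  | clear k, s => if (s.get k).length ≤ N then some (s.set k []) else none
  | emit o, s => some { s with out := o :: s.out }
  | seq P Q, s => (exec N P s).bind (exec N Q)
  | case k f, s => exec N (f (s.get k).head?) s
  | loop rev k f, s =>
    if (s.get k).length ≤ N then
      (if rev then (s.get k).reverse else s.get k).foldlM (fun s a => exec N (f a) s) s
    else none

/-- A polynomial that bounds the number of machine steps in terms of the bound on the lengths of
the registers. -/
noncomputable def time : Prog → Polynomial ℕ
  | skip => 1
  | push _ _ => 1
  | pop _ => 1
  | clear _ => Polynomial.X + 1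
  | emit _ => 1
  | seq P Q => P.time + Q.time
  | case _ f => 1 + ∑ o, (f o).time
  | loop _ _ f => 3 * (Polynomial.X + 1) + Polynomial.X * ∑ a, (f a).time

/-- The nesting depth of the loops. -/
def depth : Prog → ℕ
  | seq P Q => max P.depth Q.depth
  | case _ f => Finset.univ.sup fun o => (f o).depth
  | loop _ _ f => 1 + Finset.univ.sup fun a => (f a).depth
  | _ => 0

/-- The labels of the machine code of a program. -/
def Lab : Prog → Type
  | seq P Q => P.Lab ⊕ Q.Lab
  | case _ f => Option (Σ o, (f o).Lab)
  | loop _ _ f => Fin 3 ⊕ Σ a, (f a).Lab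
  | _ => Unit

/-- Programs have finitely many labels. -/
instance instFintypeLab : ∀ P : Prog, Fintype P.Lab
  | skip => inferInstanceAs (Fintype Unit)
  | push _ _ => inferInstanceAs (Fintype Unit)
  | pop _ => inferInstanceAs (Fintype Unit)
  | clear _ => inferInstanceAs (Fintype Unit)
  | emit _ => inferInstanceAs (Fintype Unit)
  | seq P Q =>
    letI := instFintypeLab P
    letI := instFintypeLab Q
    inferInstanceAs (Fintype (P.Lab ⊕ Q.Lab))
  | case _ f =>
    letI := fun o => instFintypeLab (f o)
    inferInstanceAs (Fintype (Option (Σ o, (f o).Lab)))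
  | loop _ _ f =>
    letI := fun a => instFintypeLab (f a)
    inferInstanceAs (Fintype (Fin 3 ⊕ Σ a, (f a).Lab))

/-- The label at which the code of a program is entered. -/
def entry : ∀ P : Prog, P.Lab
  | skip => ()
  | push _ _ => ()
  | pop _ => ()
  | clear _ => ()
  | emit _ => ()
  | seq P _ => .inl P.entry
  | case _ _ => none
  | loop _ _ _ => .inl 0

end Prog

/-! ### Compilation to stack machines -/

/-- The contents of the machines: the registers, the output, and two auxiliary contents for each
nesting level of loops. -/
inductive Stk (D : ℕ) : Type
  | reg (k : Reg)
  | out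
  | buf (d : Fin (D + 1))
  | todo (d : Fin (D + 1))
  deriving DecidableEq, Fintype

/-- The alphabets of the contents. -/
@[reducible]
def Stk.Sym {D : ℕ} : Stk D → Type
  | out => OutSym
  | _ => InSym

/-- The contents of the contents. -/
def contents {D : ℕ} (s : Store) (A B : Fin (D + 1) → List InSym) : ∀ k : Stk D, List k.Sym
  | .reg k => s.get k
  | .out => s.out
  | .buf d => A d
  | .todo d => B d

section contents

variable {D : ℕ} (s : Store) (A B : Fin (D + 1) → List InSym)

theorem update_contents_reg (k : Reg) (l : List InSym) :
    Function.update (contents s A B) (.reg k) l = contents (s.set k l) A B := by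
  funext j
  by_cases h : j = .reg k
  · subst h; simp [contents]
  · rw [Function.update_of_ne h]
    cases j with
    | reg k' => exact (s.get_set_of_ne (by rintro rfl; exact h rfl) l).symm
    | out => exact (s.out_set k l).symm
    | _ => rfl

theorem update_contents_out (l : List OutSym) :
    Function.update (contents s A B) .out l = contents { s with out := l } A B := by
  funext j
  by_cases h : j = .out
  · subst h; simp [contents]
  · rw [Function.update_of_ne h]
    cases j with
    | reg k' => cases k' <;> rfl
    | out => exact absurd rfl h
    | _ => rfl

theorem update_contents_buf (d : Fin (D + 1)) (l : List InSym) :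
    Function.update (contents s A B) (.buf d) l = contents s (Function.update A d l) B := by
  funext j
  by_cases h : j = .buf d
  · subst h; simp [contents]
  · rw [Function.update_of_ne h]
    cases j with
    | buf d' => exact (Function.update_of_ne (fun e => h (congrArg _ e)) _ _).symm
    | _ => rfl

theorem update_contents_todo (d : Fin (D + 1)) (l : List InSym) :
    Function.update (contents s A B) (.todo d) l = contents s A (Function.update B d l) := by
  funext j
  by_cases h : j = .todo d
  · subst h; simp [contents]
  · rw [Function.update_of_ne h]
    cases j with
    | todo d' => exact (Function.update_of_ne (fun e => h (congrArg _ e)) _ _).symm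
    | _ => rfl

end contents

open Turing.TM2 (Stmt Cfg)

/-- `ReachesIn M t c c'` means that the machine `M` gets from `c` to `c'` within `t` steps. -/
def ReachesIn {K Λ σ : Type} [DecidableEq K] {Γ : K → Type} (M : Λ → Stmt Γ Λ σ) (t : ℕ)
    (c c' : Cfg Γ Λ σ) : Prop :=
  ∃ u ≤ t, (flip bind (Turing.TM2.step M))^[u] (some c) = some c'

namespace ReachesIn

variable {K Λ σ : Type} [DecidableEq K] {Γ : K → Type} {M : Λ → Stmt Γ Λ σ}
  {c c' c'' : Cfg Γ Λ σ} {t t' : ℕ}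

theorem trans (h : ReachesIn M t c c') (h' : ReachesIn M t' c' c'') :
    ReachesIn M (t + t') c c'' := by
  obtain ⟨u, hu, h⟩ := h
  obtain ⟨u', hu', h'⟩ := h'
  refine ⟨u' + u, by omega, ?_⟩
  rw [Function.iterate_add_apply, h, h']

theorem mono (h : ReachesIn M t c c') (ht : t ≤ t') : ReachesIn M t' c c' :=
  let ⟨u, hu, h⟩ := h
  ⟨u, hu.trans ht, h⟩

theorem step (h : Turing.TM2.step M c = some c') : ReachesIn M 1 c c' :=
  ⟨1, le_rfl, h⟩

theorem head (h : Turing.TM2.step M c = some c') (h' : ReachesIn M t c' c'') :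
    ReachesIn M (1 + t) c c'' :=
  (step h).trans h'

end ReachesIn

namespace Prog

section stmts

variable {D : ℕ} {Λ : Type}

/-- The statement at `e` that empties a register. -/
def clearStmt (k : Reg) (e exit : Λ) : Stmt (Stk.Sym (D := D)) Λ (Option InSym) :=
  .pop (.reg k) (fun _ o => o) <| .goto fun v => if v.isSome then e else exit

/-- The statement at `e` that moves a register to the auxiliary stacks of level `d`. -/
def readStmt (rev : Bool) (k : Reg) (e exit : Λ) (d : Fin (D + 1)) :
    Stmt (Stk.Sym (D := D)) Λ (Option InSym) :=
  .pop (.reg k) (fun _ o => o) <| .branch (fun v => v.isSome)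
    (.push (.buf d) (fun v => v.getD .tick) <|
      if rev then .push (.todo d) (fun v => v.getD .tick) <| .goto fun _ => e else .goto fun _ => e)
    (.goto fun _ => exit)

/-- The statement at `e` that restores a register from the auxiliary stacks of level `d`. -/
def writeStmt (rev : Bool) (k : Reg) (e exit : Λ) (d : Fin (D + 1)) :
    Stmt (Stk.Sym (D := D)) Λ (Option InSym) :=
  .pop (.buf d) (fun _ o => o) <| .branch (fun v => v.isSome)
    (.push (.reg k) (fun v => v.getD .tick) <|
      if rev then .goto fun _ => e else .push (.todo d) (fun v => v.getD .tick) <| .goto fun _ => e)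
    (.goto fun _ => exit)

/-- The statement that fetches the next symbol of a loop. -/
def nextStmt (b : InSym → Λ) (exit : Λ) (d : Fin (D + 1)) :
    Stmt (Stk.Sym (D := D)) Λ (Option InSym) :=
  .pop (.todo d) (fun _ o => o) <| .goto fun v => v.elim exit b

/-- The statements of the machine code of a program that is placed at the labels `ι` and leaves
through the label `exit`, with loops that use the auxiliary stacks from level `d` on. -/
def code : ∀ (P : Prog) (_ : P.Lab → Λ) (_ : Λ) (_ : ℕ),
    P.Lab → Stmt (Stk.Sym (D := D)) Λ (Option InSym)
  | skip, _, exit, _, _ => .goto fun _ => exit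
  | push k a, _, exit, _, _ => .push (.reg k) (fun _ => a) <| .goto fun _ => exit
  | pop k, _, exit, _, _ => .pop (.reg k) (fun v _ => v) <| .goto fun _ => exit
  | clear k, ι, exit, _, _ => clearStmt k (ι ()) exit
  | emit o, _, exit, _, _ => .push .out (fun _ => o) <| .goto fun _ => exit
  | seq P Q, ι, exit, d, l =>
    match l with
    | .inl l => P.code (ι ∘ .inl) (ι (.inr Q.entry)) d l
    | .inr l => Q.code (ι ∘ .inr) exit d l
  | case k f, ι, exit, d, l =>
    match l with
    | none => .peek (.reg k) (fun _ o => o) <| .goto fun v => ι (some ⟨v, (f v).entry⟩)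
    | some ⟨o, l⟩ => (f o).code (fun l => ι (some ⟨o, l⟩)) exit d l
  | loop rev k f, ι, exit, d, l =>
    match l with
    | .inl 0 => readStmt rev k (ι (.inl 0)) (ι (.inl 1)) (Fin.ofNat (D + 1) d)
    | .inl 1 => writeStmt rev k (ι (.inl 1)) (ι (.inl 2)) (Fin.ofNat (D + 1) d)
    | .inl 2 => nextStmt (fun a => ι (.inr ⟨a, (f a).entry⟩)) exit (Fin.ofNat (D + 1) d)
    | .inr ⟨a, l⟩ => (f a).code (fun l => ι (.inr ⟨a, l⟩)) (ι (.inl 2)) (d + 1) l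

end stmts

/-! ### Correctness and running time of the compiled code. -/

section correctness

variable {D : ℕ} {Λ : Type} {M : Λ → Stmt (Stk.Sym (D := D)) Λ (Option InSym)}

theorem clearStmt_reachesIn {k : Reg} {e exit : Λ} (hM : M e = clearStmt k e exit)
    (A B : Fin (D + 1) → List InSym) (s : Store) (v : Option InSym) (l : List InSym) :
    ReachesIn M (l.length + 1) ⟨some e, v, contents (s.set k l) A B⟩
      ⟨some exit, none, contents (s.set k []) A B⟩ := by
  induction l generalizing v with
  | nil =>
    refine .step ?_
    simp [hM, clearStmt, update_contents_reg, contents]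
  | cons a l ih =>
    refine (ReachesIn.head ?_ (ih (some a))).mono (by simp [add_comm])
    simp [hM, clearStmt, update_contents_reg, contents]

/-- Popping reverses the register, and a backward loop needs just this reversed copy in `todo`. A
forward loop fills `todo` only when `writeStmt` restores the register, where the second reversal
recovers the original order. -/
theorem readStmt_reachesIn {rev : Bool} {k : Reg} {e exit : Λ} {d : Fin (D + 1)}
    (hM : M e = readStmt rev k e exit d)
    (s : Store) (A B : Fin (D + 1) → List InSym) (v : Option InSym) (l b c : List InSym) :
    ReachesIn M (l.length + 1)
      ⟨some e, v, contents (s.set k l) (Function.update A d b) (Function.update B d c)⟩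
      ⟨some exit, none, contents (s.set k []) (Function.update A d (l.reverse ++ b))
        (Function.update B d (if rev then l.reverse ++ c else c))⟩ := by
  induction l generalizing v b c with
  | nil =>
    refine .step ?_
    simp [hM, readStmt, update_contents_reg, contents]
  | cons a l ih =>
    have h := ih (some a) (a :: b) (if rev then a :: c else c)
    have e : (if rev then l.reverse ++ (if rev then a :: c else c) else if rev then a :: c else c) =
        if rev then (a :: l).reverse ++ c else c := by cases rev <;> simp
    rw [e, show l.reverse ++ a :: b = (a :: l).reverse ++ b by simp] at h
    refine (ReachesIn.head ?_ h).mono (by simp [add_comm])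
    cases rev <;>
      simp [hM, readStmt, update_contents_reg, update_contents_buf, update_contents_todo, contents]

theorem writeStmt_reachesIn {rev : Bool} {k : Reg} {e exit : Λ} {d : Fin (D + 1)}
    (hM : M e = writeStmt rev k e exit d)
    (s : Store) (A B : Fin (D + 1) → List InSym) (v : Option InSym) (l b c : List InSym) :
    ReachesIn M (b.length + 1)
      ⟨some e, v, contents (s.set k l) (Function.update A d b) (Function.update B d c)⟩
      ⟨some exit, none, contents (s.set k (b.reverse ++ l)) (Function.update A d [])
        (Function.update B d (if rev then c else b.reverse ++ c))⟩ := by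
  induction b generalizing v l c with
  | nil =>
    refine .step ?_
    simp [hM, writeStmt, update_contents_buf, contents]
  | cons a b ih =>
    have h := ih (some a) (a :: l) (if rev then c else a :: c)
    have e : (if rev then (if rev then c else a :: c) else b.reverse ++ if rev then c else a :: c) =
        if rev then c else (a :: b).reverse ++ c := by cases rev <;> simp
    rw [e, show b.reverse ++ a :: l = (a :: b).reverse ++ l by simp] at h
    refine (ReachesIn.head ?_ h).mono (by simp [add_comm])
    cases rev <;>
      simp [hM, writeStmt, update_contents_reg, update_contents_buf, update_contents_todo, contents]

/-- The iterations are driven by the copy in `todo`, so the body may change the looped register.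
While the body runs, level `d` holds the remaining symbols; hence its correctness is assumed only
with the levels strictly above `d` empty. -/
theorem nextStmt_reachesIn {f : InSym → Prog} {e exit : Λ} {d : Fin (D + 1)} {b : InSym → Λ}
    (hM : M e = nextStmt b exit d) {N T : ℕ}
    (ih : ∀ a (s s' : Store), (f a).exec N s = some s' →
      ∀ (A B : Fin (D + 1) → List InSym) v, (∀ j : Fin (D + 1), d < j → A j = [] ∧ B j = []) →
      ∃ v', ReachesIn M T ⟨some (b a), v, contents s A B⟩ ⟨some e, v', contents s' A B⟩)
    (A B : Fin (D + 1) → List InSym) (hAB : ∀ j : Fin (D + 1), d ≤ j → A j = [] ∧ B j = [])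
    (l : List InSym) (s s' : Store) (v : Option InSym)
    (h : l.foldlM (fun s a => (f a).exec N s) s = some s') :
    ReachesIn M (l.length * (T + 1) + 1)
      ⟨some e, v, contents s A (Function.update B d l)⟩ ⟨some exit, none, contents s' A B⟩ := by
  have hB : B d = [] := (hAB _ le_rfl).2
  induction l generalizing s v with
  | nil =>
    obtain rfl : s = s' := by simpa using h
    refine (ReachesIn.step ?_).mono (by omega)
    have : Function.update B d [] = B := by rw [← hB, Function.update_eq_self]
    simp [hM, nextStmt, update_contents_todo, contents, hB, this]
  | cons a l ih' =>
    obtain ⟨s₁, h₁, h₂⟩ : ∃ s₁, (f a).exec N s = some s₁ ∧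
        l.foldlM (fun s a => (f a).exec N s) s₁ = some s' := by
      simpa [List.foldlM_cons, Option.bind_eq_some_iff] using h
    obtain ⟨v', hr⟩ := ih a s s₁ h₁ A (Function.update B d l) (some a) (by
      intro j hj
      refine ⟨(hAB j hj.le).1, ?_⟩
      rw [Function.update_of_ne hj.ne', (hAB j hj.le).2])
    refine ((ReachesIn.head ?_ hr).trans (ih' s₁ v' h₂)).mono ?_
    · simp [hM, nextStmt, update_contents_todo, contents]
    · simp only [List.length_cons]
      ring_nf
      omega

/-- Structural induction on the program. The placement `ι` is arbitrary because subprograms occupy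
part of the labels of the whole. The auxiliary stacks from level `d` on are empty before and after,
so that sequential parts can share them. -/
theorem code_reachesIn {N : ℕ} (P : Prog) : ∀ {ι : P.Lab → Λ} {exit : Λ} {d : ℕ}
    (_ : ∀ l, M (ι l) = P.code ι exit d l) (_ : d + P.depth ≤ D + 1) (s s' : Store)
    (_ : P.exec N s = some s') (A B : Fin (D + 1) → List InSym) (v : Option InSym)
    (_ : ∀ j : Fin (D + 1), d ≤ j → A j = [] ∧ B j = []),
    ∃ v', ReachesIn M (P.time.eval N) ⟨some (ι P.entry), v, contents s A B⟩
      ⟨some exit, v', contents s' A B⟩ := by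
  induction P with
  | skip =>
    intro ι exit d hM hd s s' h A B v hAB
    obtain rfl : s = s' := by simpa [exec] using h
    rw [show time skip = 1 from rfl, Polynomial.eval_one]
    exact ⟨v, .step (by simp [hM, code])⟩
  | push k a =>
    intro ι exit d hM hd s s' h A B v hAB
    obtain rfl : s.set k (a :: s.get k) = s' := by simpa [exec] using h
    rw [show time (push k a) = 1 from rfl, Polynomial.eval_one]
    exact ⟨v, .step (by simp [hM, code, update_contents_reg, contents])⟩
  | pop k =>
    intro ι exit d hM hd s s' h A B v hAB
    obtain rfl : s.set k (s.get k).tail = s' := by simpa [exec] using h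
    rw [show time (pop k) = 1 from rfl, Polynomial.eval_one]
    exact ⟨v, .step (by simp [hM, code, update_contents_reg, contents])⟩
  | clear k =>
    intro ι exit d hM hd s s' h A B v hAB
    obtain ⟨hN, rfl⟩ : (s.get k).length ≤ N ∧ s.set k [] = s' := by simpa [exec] using h
    have hr := clearStmt_reachesIn (hM ()) A B s v (s.get k)
    rw [Store.set_get] at hr
    exact ⟨none, hr.mono (by simpa [time] using hN)⟩
  | emit o =>
    intro ι exit d hM hd s s' h A B v hAB
    obtain rfl : { s with out := o :: s.out } = s' := by simpa [exec] using h
    rw [show time (emit o) = 1 from rfl, Polynomial.eval_one]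
    exact ⟨v, .step (by simp [hM, code, update_contents_out, contents])⟩
  | seq P Q ihP ihQ =>
    intro ι exit d hM hd s s' h A B v hAB
    obtain ⟨s₁, h₁, h₂⟩ : ∃ s₁, P.exec N s = some s₁ ∧ Q.exec N s₁ = some s' := by
      simpa [exec, Option.bind_eq_some_iff] using h
    simp only [depth] at hd
    obtain ⟨v₁, hr₁⟩ := ihP (ι := ι ∘ .inl) (fun l => hM (.inl l)) (by omega) s s₁ h₁ A B v hAB
    obtain ⟨v₂, hr₂⟩ := ihQ (ι := ι ∘ .inr) (fun l => hM (.inr l)) (by omega) s₁ s' h₂ A B v₁ hAB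
    exact ⟨v₂, (hr₁.trans hr₂).mono (by simp [time])⟩
  | case k f ih =>
    intro ι exit d hM hd s s' h A B v hAB
    set o := (s.get k).head? with ho
    have hdo : (f o).depth ≤ (case k f).depth :=
      Finset.le_sup (f := fun o => (f o).depth) (Finset.mem_univ o)
    obtain ⟨v', hr⟩ := ih o (ι := fun l => ι (some ⟨o, l⟩)) (fun l => hM (some ⟨o, l⟩)) (by omega)
      s s' h A B o hAB
    refine ⟨v', (ReachesIn.head ?_ hr).mono ?_⟩
    · have hM₀ := hM none
      simp only [Turing.TM2.step]
      exact congrArg (fun q => some (Turing.TM2.stepAux q v (contents s A B))) hM₀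
    · simp only [time, Polynomial.eval_add, Polynomial.eval_one, Polynomial.eval_finsetSum]
      gcongr
      exact Finset.single_le_sum (f := fun o => (f o).time.eval N) (fun _ _ => Nat.zero_le _)
        (Finset.mem_univ o)
  | loop rev k f ih =>
    intro ι exit d hM hd s s' h A B v hAB
    obtain ⟨hN, h⟩ : (s.get k).length ≤ N ∧
        (if rev then (s.get k).reverse else s.get k).foldlM (fun s a => exec N (f a) s) s
          = some s' := by
      simpa only [exec, Option.ite_none_right_eq_some] using h
    have hfd : ∀ a, 1 + (f a).depth ≤ (loop rev k f).depth := fun a =>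
      Nat.add_le_add_left (Finset.le_sup (f := fun a => (f a).depth) (Finset.mem_univ a)) 1
    have hft : ∀ a, (f a).time.eval N ≤ (∑ a, (f a).time).eval N := fun a => by
      rw [Polynomial.eval_finsetSum]
      exact Finset.single_le_sum (f := fun a => (f a).time.eval N) (fun _ _ => Nat.zero_le _)
        (Finset.mem_univ a)
    -- `Fin.ofNat` reduces modulo `D + 1`; a loop has depth at least one, so `d ≤ D` and nothing
    -- wraps around.
    have hd' : (Fin.ofNat (D + 1) d : ℕ) = d := by
      have := hfd .tick
      exact Nat.mod_eq_of_lt (by omega)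
    have hA : Function.update A (Fin.ofNat (D + 1) d) [] = A := by
      rw [← (hAB (Fin.ofNat (D + 1) d) hd'.ge).1, Function.update_eq_self]
    have hB : Function.update B (Fin.ofNat (D + 1) d) [] = B := by
      rw [← (hAB (Fin.ofNat (D + 1) d) hd'.ge).2, Function.update_eq_self]
    have h₁ := readStmt_reachesIn (hM (.inl 0)) s A B v (s.get k) [] []
    have h₂ := writeStmt_reachesIn (hM (.inl 1)) s A B none [] (s.get k).reverse
      (if rev then (s.get k).reverse else [])
    have h₃ := nextStmt_reachesIn (hM (.inl 2)) (N := N) (T := (∑ a, (f a).time).eval N)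
      (fun a s s' hs A B v hAB => by
        have := hfd a
        obtain ⟨v', hr⟩ := ih a (ι := fun l => ι (.inr ⟨a, l⟩)) (fun l => hM (.inr ⟨a, l⟩))
          (by omega) s s' hs A B v (fun j hj => hAB j (by rw [Fin.lt_def, hd']; exact hj))
        exact ⟨v', hr.mono (hft a)⟩) A B
      (fun j hj => hAB j (by rwa [Fin.le_def, hd'] at hj)) _ s s' none h
    simp only [Store.set_get, hA, hB, List.append_nil, List.reverse_reverse] at h₁ h₂
    have e : (if rev then (if rev then (s.get k).reverse else []) else
        s.get k ++ if rev then (s.get k).reverse else []) =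
        if rev then (s.get k).reverse else s.get k := by cases rev <;> simp
    rw [e] at h₂
    -- Reading, restoring and fetching each take one step per symbol plus one to notice the end,
    -- which accounts for `3 * (N + 1)`; the rest is the time of the bodies.
    refine ⟨none, ((h₁.trans h₂).trans h₃).mono ?_⟩
    have : (if rev then (s.get k).reverse else s.get k).length = (s.get k).length := by
      cases rev <;> simp
    simp only [this, List.length_reverse, time, Polynomial.eval_add, Polynomial.eval_mul,
      Polynomial.eval_X, Polynomial.eval_one, Polynomial.eval_ofNat]
    have := Nat.mul_le_mul_right ((∑ a, (f a).time).eval N + 1) hN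
    rw [mul_add N] at this
    omega

end correctness

/-- The machine that runs a program. -/
def machine (P : Prog) : Turing.FinTM2 where
  K := Stk P.depth
  k₀ := .reg .inp
  k₁ := .out
  Γ := Stk.Sym
  Λ := Option P.Lab
  main := some P.entry
  σ := Option InSym
  initialState := none
  Γk₀Fin := inferInstanceAs (Fintype InSym)
  m
    | some l => P.code some none 0 l
    -- The internal state is reset because the halting configuration is required to carry the
    -- initial state.
    | none => .load (fun _ => none) .halt

theorem initList_machine (P : Prog) (l : List InSym) :
    Turing.initList P.machine l =
      ⟨some (some P.entry), none, contents (Store.init l []) (fun _ => []) (fun _ => [])⟩ := by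
  refine congrArg (Cfg.mk (some (some P.entry)) none) ?_
  funext k
  cases k with
  | reg k => cases k <;> rfl
  | _ => rfl

theorem haltList_machine (P : Prog) (l : List OutSym) :
    Turing.haltList P.machine l =
      ⟨none, none, contents (Store.init [] l) (fun _ => []) (fun _ => [])⟩ := by
  refine congrArg (Cfg.mk none none) ?_
  funext k
  cases k with
  | reg k => cases k <;> rfl
  | _ => rfl

/-- A function is computable in polynomial time if a program of the loop language computes it with
registers of polynomial length. -/
theorem nonempty_tm2ComputableInPolyTime {α β : Type} {ea : α → List InSym}
    {eb : β → List OutSym} {f : α → β} (P : Prog) (N : Polynomial ℕ)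
    (h : ∀ a, P.exec (N.eval (ea a).length) (.init (ea a) []) = some (.init [] (eb (f a)))) :
    Nonempty (Turing.TM2ComputableInPolyTime ea eb f) := by
  -- The additional step is the final halting statement.
  refine ⟨⟨⟨P.machine, Equiv.refl _, Equiv.refl _⟩, P.time.comp N + 1, fun a => ?_⟩⟩
  apply Classical.choice
  obtain ⟨v, hr⟩ := code_reachesIn (M := P.machine.m) P (ι := some) (exit := none) (d := 0)
    (D := P.depth) (fun _ => rfl) (by omega) _ _ (h a) (fun _ => []) (fun _ => []) none (by simp)
  obtain ⟨u, hu, hr⟩ := hr.trans (ReachesIn.step (c' := ⟨none, none, contents (.init [] (eb (f a)))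
    (fun _ => []) (fun _ => [])⟩) rfl)
  refine ⟨⟨⟨u, ?_⟩, by simpa [Polynomial.eval_comp] using hu⟩⟩
  have e₁ : List.map (Equiv.refl InSym).invFun (ea a) = ea a := List.map_id _
  have e₂ : List.map (Equiv.refl OutSym).invFun (eb (f a)) = eb (f a) := List.map_id _
  have h₁ := (congrArg (Turing.initList P.machine) e₁).trans (initList_machine P (ea a))
  have h₂ := (congrArg (Turing.haltList P.machine) e₂).trans (haltList_machine P (eb (f a)))
  refine Eq.trans ?_ (hr.trans (congrArg some h₂.symm))
  exact congrArg (fun c => (flip bind P.machine.step)^[u] (some c)) h₁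

end Prog

end ShapleyCircuits

namespace ShapleyCircuits

/-! ### Machine words -/

/-- The integer with the binary digits `l`, least significant digit first. -/
def ofBits : List Bool → ℤ
  | [] => 0
  | b :: l => (if b then 1 else 0) + 2 * ofBits l

/-- The `L` least significant binary digits of the integer `z`. -/
def word : ℕ → ℤ → List Bool
  | 0, _ => []
  | L + 1, z => decide (z % 2 = 1) :: word L (z / 2)

@[simp]
theorem length_word (L : ℕ) (z : ℤ) : (word L z).length = L := by
  induction L generalizing z with
  | zero => rfl
  | succ L ih => simp [word, ih]

theorem word_ofBits (l : List Bool) : word l.length (ofBits l) = l := by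
  induction l with
  | nil => rfl
  | cons b l ih =>
    rw [List.length_cons, word, ofBits]
    congr 1
    · cases b <;> simp
    · convert ih using 2
      cases b
      · simp
      · simp; omega

/-- With `ofBits_word_modEq` this identifies words of length `L` with residues modulo `2 ^ L`,
negative integers included. All register arithmetic is justified by congruences through these two
lemmas. -/
theorem word_eq_of_modEq {L : ℕ} {z z' : ℤ} (h : z ≡ z' [ZMOD 2 ^ L]) : word L z = word L z' := by
  obtain ⟨k, hk⟩ := h.dvd
  obtain rfl : z' = z + 2 ^ L * k := by linarith
  clear h hk
  induction L generalizing z with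
  | zero => rfl
  | succ L ih =>
    have e : z + 2 ^ (L + 1) * k = z + 2 * (2 ^ L * k) := by ring
    rw [word, word, e]
    congr 1
    · congr 2; omega
    · rw [show (z + 2 * (2 ^ L * k)) / 2 = z / 2 + 2 ^ L * k by omega]
      exact ih

theorem ofBits_word_modEq (L : ℕ) (z : ℤ) : ofBits (word L z) ≡ z [ZMOD 2 ^ L] := by
  induction L generalizing z with
  | zero => simp [Int.modEq_one]
  | succ L ih =>
    obtain ⟨k, hk⟩ := (ih (z / 2)).dvd
    refine (Int.modEq_iff_dvd.2 ⟨k, ?_⟩)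
    rw [word, ofBits, pow_succ, mul_right_comm, ← hk]
    by_cases h : z % 2 = 1 <;> simp [h] <;> omega

theorem ofBits_nonneg (l : List Bool) : 0 ≤ ofBits l := by
  induction l with
  | nil => exact le_rfl
  | cons b l ih => rw [ofBits]; split <;> omega

theorem ofBits_lt (l : List Bool) : ofBits l < 2 ^ l.length := by
  induction l with
  | nil => simp [ofBits]
  | cons b l ih => rw [ofBits, List.length_cons, pow_succ]; split <;> omega

theorem ofBits_append (l l' : List Bool) :
    ofBits (l ++ l') = ofBits l + 2 ^ l.length * ofBits l' := by
  induction l with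
  | nil => simp [ofBits]
  | cons b l ih => rw [List.cons_append, ofBits, ih, ofBits, List.length_cons, pow_succ]; ring

theorem ofBits_replicate_false (k : ℕ) : ofBits (List.replicate k false) = 0 := by
  induction k with
  | zero => rfl
  | succ k ih => rw [List.replicate_succ, ofBits, ih]; simp

theorem ofBits_map_not (l : List Bool) : ofBits (l.map not) = 2 ^ l.length - 1 - ofBits l := by
  induction l with
  | nil => simp [ofBits]
  | cons b l ih =>
    rw [List.map_cons, ofBits, ih, ofBits, List.length_cons, pow_succ]
    cases b <;> simp <;> ring

/-- Two's complement: flipping all digits is subtraction from `2 ^ L - 1`. Subtraction therefore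
needs no program beyond addition. -/
theorem ofBits_map_not_word_modEq (L : ℕ) (z : ℤ) :
    ofBits ((word L z).map not) ≡ -1 - z [ZMOD 2 ^ L] := by
  rw [ofBits_map_not, length_word]
  have h := ((Int.modEq_zero_iff_dvd.2 (dvd_refl ((2 : ℤ) ^ L))).sub_right 1).sub
    (ofBits_word_modEq L z)
  simpa using h

theorem word_zero (L : ℕ) : word L 0 = List.replicate L false := by
  induction L with
  | zero => rfl
  | succ L ih => simp [word, ih, List.replicate_succ]

/-- Addition of bit lists with carry, to the length of the first summand. -/
def addBits : Bool → List Bool → List Bool → List Bool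
  | _, [], _ => []
  | c, a :: x, r =>
    (a ^^ (r.headD false ^^ c)) ::
      addBits (a && r.headD false || a && c || r.headD false && c) x r.tail

theorem addBits_eq_word (c : Bool) (x r : List Bool) :
    addBits c x r = word x.length (ofBits r + ofBits x + if c then 1 else 0) := by
  induction x generalizing c r with
  | nil => rfl
  | cons a x ih =>
    have hr : ofBits r = (if r.headD false then 1 else 0) + 2 * ofBits r.tail := by
      cases r <;> simp [ofBits]
    rw [addBits, ih, List.length_cons, word, hr, ofBits]
    generalize r.headD false = b
    generalize ofBits r.tail = u
    generalize ofBits x = w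
    congr 1
    · cases a <;> cases b <;> cases c <;> simp <;> omega
    · congr 1
      cases a <;> cases b <;> cases c <;> simp <;> omega

/-- A list of bits as a list of symbols. -/
def syms (l : List Bool) : List InSym :=
  l.map .bit

@[simp]
theorem length_syms (l : List Bool) : (syms l).length = l.length :=
  List.length_map _

theorem reverse_syms (l : List Bool) : (syms l).reverse = syms l.reverse :=
  List.map_reverse.symm

theorem tail_syms (l : List Bool) : (syms l).tail = syms l.tail :=
  List.map_tail.symm

/-! ### Programs for arithmetic -/

namespace Prog

variable {N : ℕ}

theorem exec_seq {P Q : Prog} {s s₁ s₂ : Store} (h₁ : P.exec N s = some s₁)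
    (h₂ : Q.exec N s₁ = some s₂) : (P ;; Q).exec N s = some s₂ := by
  rw [exec, h₁, Option.bind_some, h₂]

theorem exec_eq {P : Prog} {s s₁ s₂ : Store} (h : P.exec N s = some s₁) (e : s₁ = s₂) :
    P.exec N s = some s₂ :=
  e ▸ h

theorem foldlM_cons_some {α σ : Type} {g : σ → α → Option σ} {a : α} {l : List α} {s s₁ s₂ : σ}
    (h₁ : g s a = some s₁) (h₂ : l.foldlM g s₁ = some s₂) : (a :: l).foldlM g s = some s₂ := by
  rw [List.foldlM_cons, h₁]
  exact h₂

theorem exec_loop {k : Reg} {f : InSym → Prog} {s s' : Store} {l : List InSym} (hl : s.get k = l)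
    (hN : l.length ≤ N) (h : l.foldlM (fun s a => (f a).exec N s) s = some s') :
    (loop false k f).exec N s = some s' := by
  simp [exec, hl, hN, h]

/-- A loop whose body does not depend on the symbols. -/
theorem exec_loop_count {k : Reg} {P : Prog} {s s' : Store} (F : ℕ → Store)
    (hN : (s.get k).length ≤ N) (h₀ : F 0 = s) (h₁ : F (s.get k).length = s')
    (h : ∀ i < (s.get k).length, P.exec N (F i) = some (F (i + 1))) :
    (loop false k fun _ => P).exec N s = some s' := by
  refine exec_loop rfl hN ?_
  rw [← h₁]
  generalize (s.get k) = l at h ⊢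
  subst h₀
  -- The claim is generalized to a suffix `l'` that is still to be processed after `i` iterations;
  -- `j` plays no role.
  suffices H : ∀ j, j + l.length = l.length + j → ∀ (l' : List InSym) (i : ℕ),
      i + l'.length = l.length →
      l'.foldlM (fun s _ => P.exec N s) (F i) = some (F l.length) from H 0 (by omega) l 0 (by omega)
  intro _ _ l'
  induction l' with
  | nil => intro i hi; simp at hi; simp [hi]
  | cons a l' ih =>
    intro i hi
    rw [List.length_cons] at hi
    rw [List.foldlM_cons, h i (by omega)]
    exact ih (i + 1) (by omega)

theorem foldlM_push (k : Reg) (l : List InSym) (s : Store) :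
    l.foldlM (fun s a => (push k a).exec N s) s = some (s.set k (l.reverse ++ s.get k)) := by
  induction l generalizing s with
  | nil => simp
  | cons a l ih => exact foldlM_cons_some rfl ((ih _).trans (by simp))

theorem exec_loop_push {k k' : Reg} {s : Store} (hN : (s.get k).length ≤ N) :
    (loop false k (push k')).exec N s = some (s.set k' ((s.get k).reverse ++ s.get k')) :=
  exec_loop rfl hN (foldlM_push k' _ s)

theorem exec_push {k : Reg} {a : InSym} {s : Store} :
    (push k a).exec N s = some (s.set k (a :: s.get k)) :=
  rfl

theorem exec_clear {k : Reg} {s : Store} (hN : (s.get k).length ≤ N) :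
    (clear k).exec N s = some (s.set k []) := by
  simp [exec, hN]

/-- Copies the register `k` to `k'`. -/
def copy (k k' : Reg) : Prog :=
  clear k' ;; loop true k (push k')

theorem exec_copy {k k' : Reg} {s : Store} (hk : k ≠ k') (h : (s.get k).length ≤ N)
    (h' : (s.get k').length ≤ N) : (copy k k').exec N s = some (s.set k' (s.get k)) := by
  refine exec_seq (exec_clear h') ?_
  rw [exec, if_pos (by rwa [Store.get_set_of_ne _ hk]), if_pos rfl, foldlM_push]
  simp [Store.get_set_of_ne _ hk]

/-- Copies the register `k` to `k'` in reversed order. -/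
def flip (k k' : Reg) : Prog :=
  clear k' ;; loop false k (push k')

theorem exec_flip {k k' : Reg} {s : Store} (hk : k ≠ k') (h : (s.get k).length ≤ N)
    (h' : (s.get k').length ≤ N) : (flip k k').exec N s = some (s.set k' (s.get k).reverse) := by
  refine exec_seq (exec_clear h') ?_
  rw [exec_loop_push (by rwa [Store.get_set_of_ne _ hk])]
  simp [Store.get_set_of_ne _ hk]

/-- The bit that a symbol stands for. -/
def bitOf : InSym → Bool
  | .bit b => b
  | _ => false

/-- One digit of an addition. -/
def addDigit (a b c : Bool) : Prog :=
  pop .acc ;; pop .carry ;; push .tmp (.bit (a ^^ (b ^^ c))) ;;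
    if a && b || a && c || b && c then push .carry .tick else skip

/-- The body of the loop of an addition. -/
def addBody (f : Bool → Bool) (a : InSym) : Prog :=
  case .acc fun b => case .carry fun c =>
    addDigit (f (bitOf a)) ((b.map bitOf).getD false) c.isSome

/-- Adds the digits `f a`, where `a` runs through the digits in `arg`, to the word in `acc`,
truncating the result to the length of `arg`. -/
def add (f : Bool → Bool) : Prog :=
  loop false .arg (addBody f) ;; clear .acc ;; loop false .tmp (push .acc) ;; clear .tmp ;; clear .carry

/-- The carry is the presence of a symbol in `carry`. The outgoing carry `c'` is left unspecified
since truncation discards it, and the digits arrive in `tmp` in reversed order. -/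
theorem foldlM_addBody (f : Bool → Bool) (x : List Bool) (s : Store) (r : List Bool) (c : Bool)
    (t : List InSym) : ∃ c' : Bool,
    (syms x).foldlM (fun s a => (addBody f a).exec N s)
      { s with acc := syms r, carry := if c then [.tick] else [], tmp := t } =
    some { s with
      acc := syms (r.drop x.length)
      carry := if c' then [.tick] else []
      tmp := (syms (addBits c (x.map f) r)).reverse ++ t } := by
  induction x generalizing r c t with
  | nil => exact ⟨c, by simp [syms, addBits]⟩
  | cons a x ih =>
    obtain ⟨c', h⟩ := ih r.tail (f a && r.headD false || f a && c || r.headD false && c)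
      (.bit (f a ^^ (r.headD false ^^ c)) :: t)
    refine ⟨c', ?_⟩
    have hb : ((syms r).head?.map bitOf).getD false = r.headD false := by
      cases r <;> simp [syms, bitOf]
    have hc : ((if c then [InSym.tick] else []).head?).isSome = c := by cases c <;> rfl
    have h' : (addBody f (.bit a)).exec N
        { s with acc := syms r, carry := if c then [.tick] else [], tmp := t } =
        some { s with
          acc := syms r.tail
          carry := if f a && r.headD false || f a && c || r.headD false && c then [.tick] else []
          tmp := .bit (f a ^^ (r.headD false ^^ c)) :: t } := by
      simp only [addBody, exec, Store.get, hb, hc]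
      rw [← tail_syms]
      generalize r.headD false = b
      simp only [bitOf]
      cases f a <;> cases b <;> cases c <;> rfl
    refine foldlM_cons_some h' (h.trans ?_)
    simp [addBits, syms]

theorem exec_add (f : Bool → Bool) {s : Store} {x r : List Bool} (hx : s.arg = syms x)
    (hr : s.acc = syms r) (ht : s.tmp = []) (hc : s.carry = []) (hxN : x.length ≤ N)
    (hrN : r.length ≤ N) (hN : 1 ≤ N) :
    (add f).exec N s =
      some (s.set .acc (syms (word x.length (ofBits r + ofBits (x.map f))))) := by
  obtain ⟨c', h⟩ := foldlM_addBody (N := N) f x s r false []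
  have hs : s = { s with acc := syms r, carry := if false then [.tick] else [], tmp := [] } := by
    cases s; simp_all
  rw [← hs] at h
  refine exec_seq (exec_loop hx (by simpa using hxN) h) ?_
  refine exec_seq (exec_clear ?_) <| exec_seq (exec_loop_push ?_) <| exec_seq (exec_clear ?_) <|
    (exec_clear ?_).trans ?_
  · simp [Store.get]; omega
  · simpa [Store.get, Store.set, addBits_eq_word] using hxN
  · simpa [Store.get, Store.set, addBits_eq_word] using hxN
  · simp [Store.get, Store.set]; split <;> simp [hN]
  · cases s; simp_all [Store.get, Store.set, addBits_eq_word]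

/-- Writes the product of `arg` and the word whose reversal is in `fac` to `acc`. -/
def mul : Prog :=
  copy .len .acc ;; loop false .fac fun b => push .acc (.bit false) ;; add fun a => bitOf b && a

theorem ofBits_map_and (b : Bool) (l : List Bool) :
    ofBits (l.map fun a => b && a) = (if b then 1 else 0) * ofBits l := by
  cases b with
  | true => simp
  | false =>
    have : (l.map fun a => false && a) = List.replicate l.length false := by
      simp [List.map_const']
    rw [this, ofBits_replicate_false]; simp

/-- Horner's scheme from the most significant digit: pushing a zero digit doubles the accumulator,
then `a` times the current digit is added. The accumulator briefly has `L + 1` digits before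
addition truncates it. -/
theorem foldlM_mul {L : ℕ} {a : ℤ} {s : Store} (hx : s.arg = syms (word L a)) (ht : s.tmp = [])
    (hc : s.carry = []) (hN : L + 1 ≤ N) (l : List Bool) (z : ℤ) :
    (syms l).foldlM (fun s b =>
      (push .acc (.bit false) ;; add fun a => bitOf b && a).exec N s)
      { s with acc := syms (word L z) } =
    some { s with acc := syms (word L (z * 2 ^ l.length + a * ofBits l.reverse)) } := by
  induction l generalizing z with
  | nil => simp [syms, ofBits]
  | cons b l ih =>
    have h : (push .acc (.bit false) ;; add fun a => bitOf (.bit b) && a).exec N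
        { s with acc := syms (word L z) } =
        some { s with acc := syms (word L (2 * z + (if b then 1 else 0) * a)) } := by
      refine exec_seq exec_push (exec_eq (exec_add (x := word L a) (r := false :: word L z) _
        hx rfl ht hc (by rw [length_word]; omega) (by simpa) (by omega)) ?_)
      rw [length_word]
      refine congrArg (fun w => { s with acc := syms w }) (word_eq_of_modEq ?_)
      rw [show ofBits (false :: word L z) = 2 * ofBits (word L z) by simp [ofBits]]
      refine ((ofBits_word_modEq L z).mul_left 2).add ?_
      rw [show (fun a => bitOf (.bit b) && a) = fun a => b && a from rfl, ofBits_map_and]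
      exact (ofBits_word_modEq L a).mul_left _
    refine foldlM_cons_some h ((ih _).trans ?_)
    refine congrArg (fun z => some { s with acc := syms (word L z) }) ?_
    rw [List.reverse_cons, ofBits_append, List.length_cons, List.length_reverse, pow_succ]
    simp only [ofBits]
    ring

theorem exec_mul {L : ℕ} {a b : ℤ} {s : Store} (hx : s.arg = syms (word L a))
    (hy : s.fac = (syms (word L b)).reverse) (hl : s.len = syms (word L 0)) (ht : s.tmp = [])
    (hc : s.carry = []) (hN : L + 1 ≤ N) (hr : s.acc.length ≤ N) :
    mul.exec N s = some (s.set .acc (syms (word L (a * b)))) := by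
  refine exec_seq (exec_copy (by decide) (by simp [Store.get, hl]; omega) hr) ?_
  refine exec_loop (hy.trans (reverse_syms _)) (by simp; omega) ?_
  have := foldlM_mul hx ht hc hN (word L b).reverse 0
  rw [show s.set .acc (s.get .len) = { s with acc := syms (word L 0) } by
    simp [Store.get, Store.set, hl], this]
  refine congrArg (fun w => some { s with acc := syms w }) (word_eq_of_modEq ?_)
  simpa using (ofBits_word_modEq L b).mul_left a

/-- Writes the word with the given two least significant digits to `acc`. -/
def const (b₁ b₀ : Bool) : Prog :=
  copy .len .arg ;; clear .acc ;; push .acc (.bit b₁) ;; push .acc (.bit b₀) ;; add id ;;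
    clear .arg

/-- Adding a short or long digit string to the zero word brings it to length `L`, because `add`
returns as many digits as `arg` has. `exec_setPowers` and `exec_shiftWeights` use the same device.
-/
theorem exec_const (b₁ b₀ : Bool) {L : ℕ} {s : Store} (hl : s.len = syms (word L 0))
    (ht : s.tmp = []) (hc : s.carry = []) (hN : L ≤ N) (hN' : 2 ≤ N) (hr : s.acc.length ≤ N)
    (hx : s.arg = []) :
    (const b₁ b₀).exec N s = some (s.set .acc
      (syms (word L ((if b₀ then 1 else 0) + 2 * if b₁ then 1 else 0)))) := by
  refine exec_seq (exec_copy (by decide) (by simpa [Store.get, hl] using hN)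
      (by simp [Store.get, hx])) <| exec_seq (exec_clear hr) <| exec_seq exec_push <| exec_seq exec_push <|
    exec_seq (exec_add (x := word L 0) (r := [b₀, b₁]) id hl rfl ht hc (by simpa) (by simpa)
      (by omega)) <| exec_eq (exec_clear ?_) ?_
  · simpa [Store.get, Store.set, hl] using hN
  · simp [Store.get, Store.set, hx, word_zero, ofBits_replicate_false, ofBits]

end Prog

end ShapleyCircuits

namespace ShapleyCircuits

/-! ### Evaluation of circuits -/

namespace Prog

/-- Moves a word from `cur` to `fac`. -/
def take : Prog :=
  loop false .len fun _ => case .cur fun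
    | some a => pop .cur ;; push .fac a
    | none => skip

/-- Combines `acc` with the word whose reversal is in `fac`. -/
def combine : Prog :=
  case .op fun
    | some .and => copy .acc .arg ;; mul
    | some .not => flip .fac .arg ;; add not
    | _ => flip .fac .arg ;; add id

/-- Reads a word from `cur` and combines it with `acc` if `b` is true. -/
def readBit (b : Bool) : Prog :=
  take ;; (if b then combine else skip) ;; clear .fac ;; clear .arg

/-- Writes the value of a variable to `acc`. -/
def setVar : Prog :=
  case .cmp fun
    | some .sep => copy .qq .acc
    | _ => copy .pp .acc

/-- Processes a symbol of the description of a circuit. -/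
def dispatch : InSym → Prog
  | .const b => const false b
  | .var => copy .idx .cmp ;; setVar
  | .tick => pop .cmp ;; setVar
  | .and => const false true ;; push .op .and
  | .or => const false false
  | .not => const true false ;; push .op .not
  | .bit b => case .cur fun
    | none => if b then copy .acc .res else skip
    | some _ => readBit b
  | .sep => loop false .acc (push .ntab) ;; clear .acc ;; clear .op ;; clear .cmp ;; copy .tab .cur

/-- Updates the table of the values of the gates. -/
def round : Prog :=
  copy .tab .cur ;; loop false .body dispatch ;; flip .ntab .tab ;; clear .ntab ;; clear .cur

/-- Adds a word to the table for each separator. -/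
def addEntry : InSym → Prog
  | .sep => loop false .len (push .tab)
  | _ => skip

/-- Computes the value of the output gate. -/
def evaluate : Prog :=
  loop false .body addEntry ;;
  loop false .body (fun _ => round) ;; clear .tab

/-- The operation of a gate on values; negations start from the value `2`. -/
def gateOp : Option InSym → ℤ → ℤ → ℤ
  | some .and, a, v => a * v
  | some .not, a, v => a + (-1 - v)
  | _, a, v => a + v

/-- The scratch registers of the arithmetic programs are empty. -/
structure Ready (N L : ℕ) (s : Store) : Prop where
  len : s.len = syms (word L 0)
  arg : s.arg = []
  fac : s.fac = []
  tmp : s.tmp = []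
  carry : s.carry = []
  bound : L + 2 ≤ N

variable {N L : ℕ}

theorem exec_take {s : Store} (hs : Ready N L s) {l rest : List InSym} (hl : l.length = L)
    (hc : s.cur = l ++ rest) :
    take.exec N s = some { s with cur := rest, fac := l.reverse } := by
  have hb := hs.bound
  have hlen : (s.get .len).length = L := by simp [Store.get, hs.len]
  refine exec_loop_count
    (fun i => { s with cur := l.drop i ++ rest, fac := (l.take i).reverse }) (by omega) ?_ ?_ ?_
  · have := hs.fac
    cases s; simp_all
  · rw [hlen, ← hl]; simp
  · intro i hi
    rw [hlen, ← hl] at hi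
    simp only [exec, Store.get, List.drop_eq_getElem_cons hi, List.cons_append, List.head?_cons,
      Store.set, Option.bind_some, List.tail_cons, List.take_succ_eq_append_getElem hi,
      List.reverse_append, List.reverse_singleton, List.nil_append]

theorem exec_flip_add (f : Bool → Bool) {s : Store} (hs : Ready N L { s with fac := [] })
    {a v v' : ℤ} (ha : s.acc = syms (word L a)) (hf : s.fac = (syms (word L v)).reverse)
    (hv : ofBits ((word L v).map f) ≡ v' [ZMOD 2 ^ L]) :
    (flip .fac .arg ;; add f).exec N s =
      some { s with acc := syms (word L (a + v')), arg := syms (word L v) } := by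
  have hb := hs.bound
  have harg : s.arg = [] := hs.arg
  have hfac : s.fac.reverse = syms (word L v) := by rw [hf, List.reverse_reverse]
  refine exec_seq (exec_flip (by decide) (by simp [Store.get, hf]; omega)
    (by simp [Store.get, harg])) <| exec_eq (exec_add (x := word L v) (r := word L a) f
      hfac ha hs.tmp hs.carry (by simp; omega) (by simp; omega) (by omega)) ?_
  rw [length_word, word_eq_of_modEq ((ofBits_word_modEq L a).add hv)]
  simp [Store.set, Store.get, hfac]

/-- The word left in `arg` depends on the branch taken and is cleared by the caller, so it is only
asserted to be a word `z`. -/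
theorem exec_combine {s : Store} (hs : Ready N L { s with fac := [] }) {a v : ℤ}
    (ha : s.acc = syms (word L a)) (hf : s.fac = (syms (word L v)).reverse) :
    ∃ z, combine.exec N s = some { s with
      acc := syms (word L (gateOp s.op.head? a v))
      arg := syms (word L z) } := by
  have hb := hs.bound
  have harg : s.arg = [] := hs.arg
  rw [combine, exec, show s.get .op = s.op from rfl]
  have h₁ := exec_flip_add not hs ha hf (ofBits_map_not_word_modEq L v)
  have h₂ := exec_flip_add id hs ha hf (by simpa using ofBits_word_modEq L v)
  have h₃ : (copy .acc .arg ;; mul).exec N s =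
      some { s with acc := syms (word L (a * v)), arg := syms (word L a) } := by
    refine exec_seq (exec_copy (by decide) (by simp [Store.get, ha]; omega)
      (by simp [Store.get, harg])) <| exec_eq (exec_mul (L := L) (a := a) (b := v) ha hf hs.len
        hs.tmp hs.carry (by omega) (by simp [Store.set, ha]; omega)) ?_
    simp [Store.set, Store.get, ha]
  generalize s.op.head? = o
  match o with
  | some .and => exact ⟨a, h₃⟩
  | some .not => exact ⟨v, h₁⟩
  | none | some .or | some .tick | some .sep | some (.bit _) | some (.const _) | some .var =>
    exact ⟨v, h₂⟩

theorem exec_readBit {s : Store} (hs : Ready N L s) (b : Bool) {a v : ℤ} {rest : List InSym}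
    (ha : s.acc = syms (word L a)) (hc : s.cur = syms (word L v) ++ rest) :
    (readBit b).exec N s = some { s with
      acc := syms (word L (if b then gateOp s.op.head? a v else a))
      cur := rest } := by
  have hb := hs.bound
  have hfac := hs.fac
  have harg := hs.arg
  refine exec_seq (exec_take hs (by simp) hc) ?_
  cases b with
  | true =>
    obtain ⟨z, hz⟩ := exec_combine (N := N) (L := L)
      (s := { s with cur := rest, fac := (syms (word L v)).reverse })
      ⟨hs.len, hs.arg, rfl, hs.tmp, hs.carry, hs.bound⟩ ha rfl
    refine exec_seq hz <| exec_seq (exec_clear ?_) <| exec_eq (exec_clear ?_) ?_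
    · simp [Store.get]; omega
    · simp [Store.get, Store.set]; omega
    · simp [Store.set, hfac, harg]
  | false =>
    refine exec_seq rfl <| exec_seq (exec_clear ?_) <| exec_eq (exec_clear ?_) ?_
    · simp [Store.get]; omega
    · simp [Store.get, Store.set, harg]
    · simp [Store.set, hfac, harg, ha]

/-- The words of a list of values. -/
def words (L : ℕ) (vs : List ℤ) : List InSym :=
  vs.flatMap fun v => syms (word L v)

theorem words_cons (L : ℕ) (v : ℤ) (vs : List ℤ) :
    words L (v :: vs) = syms (word L v) ++ words L vs :=
  rfl

theorem length_words (L : ℕ) (vs : List ℤ) : (words L vs).length = vs.length * L := by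
  induction vs with
  | nil => simp [words]
  | cons v vs ih => rw [words_cons]; simp [ih]; ring

/-- Each bit of the adjacency row consumes one word of `cur`. Positivity of `L` matters: a nonempty
`cur` is what distinguishes a row bit from the output bit that follows the row. -/
theorem foldlM_row (hL : 0 < L) (row : List (Bool × ℤ)) {s : Store} (hs : Ready N L s) (a : ℤ) :
    (row.map fun p => InSym.bit p.1).foldlM (fun s a => (dispatch a).exec N s)
      { s with acc := syms (word L a), cur := words L (row.map Prod.snd) } =
    some { s with
      acc := syms (word L (row.foldl (fun a p => if p.1 then gateOp s.op.head? a p.2 else a) a))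
      cur := [] } := by
  induction row generalizing a with
  | nil => rfl
  | cons p row ih =>
    refine foldlM_cons_some ?_ (ih _)
    have h := exec_readBit (N := N) (L := L) (a := a) (v := p.2)
      (s := { s with acc := syms (word L a), cur := words L ((p :: row).map Prod.snd) })
      (rest := words L (row.map Prod.snd))
      ⟨hs.len, hs.arg, hs.fac, hs.tmp, hs.carry, hs.bound⟩ p.1 rfl rfl
    refine Eq.trans ?_ h
    obtain ⟨L, rfl⟩ := Nat.exists_eq_succ_of_ne_zero hL.ne'
    rfl

theorem foldlM_append_some {α σ : Type} {g : σ → α → Option σ} {l l' : List α} {s s₁ s₂ : σ}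
    (h₁ : l.foldlM g s = some s₁) (h₂ : l'.foldlM g s₁ = some s₂) :
    (l ++ l').foldlM g s = some s₂ := by
  rw [List.foldlM_append, h₁]
  exact h₂

theorem exec_setVar {s : Store} (hp : s.pp.length ≤ N) (hq : s.qq.length ≤ N)
    (ha : s.acc.length ≤ N) : setVar.exec N s =
      some { s with acc := if s.cmp.head? = some .sep then s.qq else s.pp } := by
  rw [setVar, exec, show s.get .cmp = s.cmp from rfl]
  have h₁ : (copy .qq .acc).exec N s = some { s with acc := s.qq } := exec_copy (by decide) hq ha
  have h₂ : (copy .pp .acc).exec N s = some { s with acc := s.pp } := exec_copy (by decide) hp ha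
  generalize s.cmp.head? = o
  match o with
  | some .sep => exact h₁
  | none | some .or | some .tick | some .and | some (.bit _) | some (.const _) | some .var
  | some .not => exact h₂

/-- A unary variable index has no end marker, so `acc` is rewritten after every tick and only the
last rewriting counts. -/
theorem foldlM_ticks (s : Store) (hp : s.pp.length ≤ N) (hq : s.qq.length ≤ N) (x : ℕ)
    (c : List InSym) :
    (List.replicate x InSym.tick).foldlM (fun s a => (dispatch a).exec N s)
      { s with cmp := c, acc := if c.head? = some .sep then s.qq else s.pp } =
    some { s with
      cmp := c.drop x
      acc := if (c.drop x).head? = some .sep then s.qq else s.pp } := by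
  induction x generalizing c with
  | zero => rfl
  | succ x ih =>
    refine foldlM_cons_some (s₁ :=
      { s with cmp := c.tail, acc := if c.tail.head? = some .sep then s.qq else s.pp }) ?_ ?_
    · exact exec_seq rfl (exec_setVar hp hq (by
        simp only [Store.set]
        split <;> assumption))
    · rw [← List.drop_tail]; exact ih _

end Prog

/-- The value that a gate starts from, where `wt` is the valuation of the variables. -/
def Label.start {n : ℕ} (wt : Fin n → ℤ) : Label n → ℤ
  | .const b => if b then 1 else 0
  | .var x => wt x
  | .and => 1
  | .or => 0
  | .not => 2

/-- The symbol for the operation of a gate. -/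
def Label.opSym {n : ℕ} : Label n → List InSym
  | .and => [.and]
  | .not => [.not]
  | _ => []

namespace Prog

/-- The registers before the description of a gate is read, where the values of the gates in the
table are `vs`, the variable `i` has the value `q` and the other variables have the value `p`. -/
structure GateReady (N L i : ℕ) (p q : ℤ) (vs : List ℤ) (s : Store) : Prop extends
    Ready N L s where
  idx : s.idx = List.replicate i .tick ++ [.sep]
  pp : s.pp = syms (word L p)
  qq : s.qq = syms (word L q)
  tab : s.tab = words L vs
  cur : s.cur = words L vs
  acc : s.acc = []
  op : s.op = []
  cmp : s.cmp = []
  idx_le : i + 1 ≤ N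
  tab_le : vs.length * L ≤ N
  res_le : s.res.length ≤ N

variable {i : ℕ} {p q : ℤ} {vs : List ℤ}

theorem foldlM_label {n : ℕ} (l : Label n) {s : Store} (hs : GateReady N L i p q vs s) :
    ∃ c : List InSym, c.length ≤ i + 1 ∧
      l.encode.foldlM (fun s a => (dispatch a).exec N s) s = some { s with
        acc := syms (word L (l.start fun x => if (x : ℕ) = i then q else p))
        op := l.opSym
        cmp := c } := by
  have hb := hs.bound
  have hacc := hs.acc
  have hop := hs.op
  have hcmp := hs.cmp
  have hconst : ∀ b₁ b₀, (const b₁ b₀).exec N s = some { s with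
      acc := syms (word L ((if b₀ then 1 else 0) + 2 * if b₁ then 1 else 0)) } := fun b₁ b₀ =>
    exec_const b₁ b₀ hs.len hs.tmp hs.carry (by omega) (by omega) (by simp [hacc]) hs.arg
  cases l with
  | const b =>
    refine ⟨[], by simp, foldlM_cons_some (hconst false b) ?_⟩
    simp [Label.start, Label.opSym, hop, hcmp]
  | and =>
    refine ⟨[], by simp, foldlM_cons_some (exec_seq (hconst false true) exec_push) ?_⟩
    simp [Label.start, Label.opSym, hcmp, Store.get, Store.set, hop]
  | or =>
    refine ⟨[], by simp, foldlM_cons_some (hconst false false) ?_⟩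
    simp [Label.start, Label.opSym, hop, hcmp]
  | not =>
    refine ⟨[], by simp, foldlM_cons_some (exec_seq (hconst true false) exec_push) ?_⟩
    simp [Label.start, Label.opSym, hcmp, Store.get, Store.set, hop]
  | var x =>
    have hidx := hs.idx_le
    have hp : s.pp.length ≤ N := by rw [hs.pp]; simp; omega
    have hq : s.qq.length ≤ N := by rw [hs.qq]; simp; omega
    refine ⟨s.idx.drop x, by simp [hs.idx], foldlM_cons_some (exec_seq (exec_copy (by decide)
      (by simp [Store.get, hs.idx]; omega) (by simp [Store.get, hcmp]))
      (exec_setVar hp hq (by simp [Store.set, hacc]))) ?_⟩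
    refine (foldlM_ticks s hp hq x s.idx).trans ?_
    -- Removing `x` symbols from `i` ticks and a separator exposes a tick if `x < i`, the separator
    -- if `x = i`, and nothing if `x > i`.
    have : ((s.idx.drop x).head? = some .sep) ↔ (x : ℕ) = i := by
      rw [hs.idx, List.head?_drop]
      rcases lt_trichotomy (x : ℕ) i with h | h | h
      · rw [List.getElem?_append_left (by simpa)]
        simp [h, h.ne]
      · simp [h]
      · rw [List.getElem?_eq_none (by simp; omega)]
        simp [h.ne']
    simp only [this, Label.start, Label.opSym, hop, hs.pp, hs.qq]
    split <;> rfl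

/-- The new value of a gate with label `l` and the row `row` of pairs of bits of the adjacency
matrix and values of gates. -/
def gateValueOf {n : ℕ} (wt : Fin n → ℤ) (l : Label n) (row : List (Bool × ℤ)) : ℤ :=
  row.foldl (fun a p => if p.1 then gateOp l.opSym.head? a p.2 else a) (l.start wt)

/-- When the row is exhausted `cur` is empty, so the next bit is taken as the output flag and
decides whether the value goes to `res`. The closing separator files the value in `ntab` and
restores the scratch registers for the next gate. -/
theorem foldlM_block {n : ℕ} (l : Label n) (row : List (Bool × ℤ)) (o : Bool) {s : Store}
    (hL : 0 < L) (hs : GateReady N L i p q (row.map Prod.snd) s) :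
    List.foldlM (fun s a => (dispatch a).exec N s) s
      (l.encode ++ row.map (fun p => InSym.bit p.1) ++ [.bit o, .sep]) =
    some { s with
      res := if o then
          syms (word L (gateValueOf (fun x : Fin n => if (x : ℕ) = i then q else p) l row))
        else s.res
      ntab := (syms (word L
        (gateValueOf (fun x : Fin n => if (x : ℕ) = i then q else p) l row))).reverse ++ s.ntab }
      := by
  have hb := hs.bound
  have hi := hs.idx_le
  have ht := hs.tab_le
  have hr := hs.res_le
  obtain ⟨c, hc, h⟩ := foldlM_label l hs
  have h' := foldlM_row (N := N) hL row (s := { s with op := l.opSym, cmp := c })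
    ⟨hs.len, hs.arg, hs.fac, hs.tmp, hs.carry, hs.bound⟩
    (l.start fun x => if (x : ℕ) = i then q else p)
  rw [← hs.cur] at h'
  refine foldlM_append_some (foldlM_append_some h h') ?_
  clear h h'
  change List.foldlM _ { s with
    op := l.opSym
    cmp := c
    acc := syms (word L (gateValueOf (fun x : Fin n => if (x : ℕ) = i then q else p) l row))
    cur := [] } _ = _
  generalize gateValueOf (fun x : Fin n => if (x : ℕ) = i then q else p) l row = v
  have hop : l.opSym.length ≤ N := by cases l <;> simp [Label.opSym] <;> omega
  refine foldlM_cons_some (s₁ := { s with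
    op := l.opSym
    cmp := c
    acc := syms (word L v)
    cur := []
    res := if o then syms (word L v) else s.res }) ?_ ?_
  · cases o with
    | true => exact exec_eq (exec_copy (by decide) (by simp [Store.get]; omega) hr) rfl
    | false => rfl
  refine foldlM_cons_some (exec_seq (exec_loop_push ?_) <| exec_seq (exec_clear ?_) <|
    exec_seq (exec_clear ?_) <| exec_seq (exec_clear ?_) <|
    exec_copy (by decide) ?_ ?_) ?_
  · simp [Store.get]; omega
  · simp [Store.get, Store.set]; omega
  · simpa [Store.get, Store.set]
  · simp [Store.get, Store.set]; omega
  · simp [Store.get, Store.set, hs.tab, length_words]; simpa using ht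
  · simp [Store.get, Store.set]
  · simp [Store.get, Store.set, hs.tab, hs.cur, hs.acc, hs.op, hs.cmp]

end Prog

/-! ### Circuit descriptions and simultaneous updates of all gates. -/

namespace Circuit

variable {n : ℕ} (C : Circuit n)

/-- The description of a gate. -/
def block (g : Fin C.size) : List InSym :=
  (C.label g).encode ++ (List.finRange C.size).map (fun h => .bit (decide (h ∈ C.inputs g))) ++
    [.bit (decide (g = C.output)), .sep]

/-- The descriptions of all gates. -/
def blocks : List InSym :=
  (List.finRange C.size).flatMap C.block

theorem encode_eq : C.encode = List.replicate n .tick ++ .sep :: C.blocks := by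
  rw [encode, List.append_assoc]
  rfl

/-- The new value of a gate, computed from the values `v` of all gates. -/
def stepValue (wt : Fin n → ℤ) (v : Fin C.size → ℤ) (g : Fin C.size) : ℤ :=
  Prog.gateValueOf wt (C.label g)
    ((List.finRange C.size).map fun h => (decide (h ∈ C.inputs g), v h))

end Circuit

namespace Prog

variable {n : ℕ} (C : Circuit n)

/-- Throughout a round `tab` keeps the old values and `ntab` collects the new ones, so all gates are
updated from the same `v`, whatever order they are listed in. -/
theorem foldlM_blocks (hL : 0 < L) (v : Fin C.size → ℤ) (l : List (Fin C.size)) {s : Store}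
    (hs : GateReady N L i p q ((List.finRange C.size).map v) s) :
    (l.flatMap C.block).foldlM (fun s a => (dispatch a).exec N s) s =
    some { s with
      res := if C.output ∈ l then
          syms (word L (C.stepValue (fun x => if (x : ℕ) = i then q else p) v C.output))
        else s.res
      ntab := (words L
        (l.map (C.stepValue (fun x => if (x : ℕ) = i then q else p) v))).reverse ++ s.ntab } := by
  induction l generalizing s with
  | nil => simp [words]
  | cons g l ih =>
    have h := foldlM_block (N := N) (C.label g)
      ((List.finRange C.size).map fun h => (decide (h ∈ C.inputs g), v h))
      (decide (g = C.output)) (s := s) (p := p) (q := q) (i := i) hL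
      (by simpa [List.map_map, Function.comp_def] using hs)
    have e : ((List.finRange C.size).map fun h => (decide (h ∈ C.inputs g), v h)).map
        (fun p => InSym.bit p.1) =
        (List.finRange C.size).map (fun h => .bit (decide (h ∈ C.inputs g))) := by
      simp [List.map_map, Function.comp_def]
    rw [e] at h
    refine foldlM_append_some h ((ih ?_).trans ?_)
    · have := hs.bound
      exact ⟨⟨hs.len, hs.arg, hs.fac, hs.tmp, hs.carry, hs.bound⟩, hs.idx, hs.pp, hs.qq, hs.tab,
        hs.cur, hs.acc, hs.op, hs.cmp, hs.idx_le, hs.tab_le, by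
          simp only
          split
          · simp; omega
          · exact hs.res_le⟩
    · congr 2
      · rw [List.map_cons, words_cons, List.reverse_append, List.append_assoc]
        rfl
      · dsimp only
        by_cases h₁ : C.output ∈ l
        · simp [h₁]
        · by_cases h₂ : g = C.output
          · subst h₂
            simp only [h₁, if_false, decide_true, if_true, List.mem_cons, true_or]
            rfl
          · simp [h₁, h₂, Ne.symm h₂]

/-- The registers before the table is updated. -/
structure RoundReady (N L i : ℕ) (p q : ℤ) (s : Store) : Prop extends Ready N L s where
  idx : s.idx = List.replicate i .tick ++ [.sep]
  pp : s.pp = syms (word L p)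
  qq : s.qq = syms (word L q)
  cur : s.cur = []
  acc : s.acc = []
  op : s.op = []
  cmp : s.cmp = []
  ntab : s.ntab = []
  idx_le : i + 1 ≤ N
  res_le : s.res.length ≤ N

theorem exec_round (hL : 0 < L) (v : Fin C.size → ℤ) {s : Store} (hs : RoundReady N L i p q s)
    (ht : s.tab = words L ((List.finRange C.size).map v)) (hb : s.body = C.blocks)
    (hbN : C.blocks.length ≤ N) (hN : C.size * L ≤ N) :
    round.exec N s = some { s with
      tab := words L ((List.finRange C.size).map
        (C.stepValue (fun x => if (x : ℕ) = i then q else p) v))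
      res := syms (word L
        (C.stepValue (fun x => if (x : ℕ) = i then q else p) v C.output)) } := by
  have hcur := hs.cur
  have hntab := hs.ntab
  have h := foldlM_blocks (N := N) C hL v (List.finRange C.size)
    (s := { s with cur := words L ((List.finRange C.size).map v) }) (i := i) (p := p) (q := q)
    ⟨⟨hs.len, hs.arg, hs.fac, hs.tmp, hs.carry, hs.bound⟩, hs.idx, hs.pp, hs.qq, ht,
        rfl, hs.acc, hs.op, hs.cmp, hs.idx_le, by simpa using hN, hs.res_le⟩
  rw [← ht] at h
  refine exec_seq (exec_copy (by decide) ?_ ?_) <| exec_seq (exec_loop hb hbN h) <|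
    exec_seq (exec_flip (by decide) ?_ ?_) <| exec_seq (exec_clear ?_) <|
    exec_eq (exec_clear ?_) ?_
  · simpa [Store.get, ht, length_words] using hN
  · simp [Store.get, hs.cur]
  · simpa [Store.get, hntab, length_words] using hN
  · simpa [Store.get, ht, length_words] using hN
  · simpa [Store.get, Store.set, hntab, length_words] using hN
  · simpa [Store.get, Store.set, ht, length_words] using hN
  · simp [Store.get, Store.set, hntab, hcur]

/-- The number of gates is not stored anywhere; it is recovered as the number of separators, which
gives the size of the initial table of zeros. -/
theorem filter_blocks : (C.blocks.filter fun a => decide (a = .sep)).length = C.size := by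
  have h : ∀ g, ((C.block g).filter fun a => decide (a = .sep)) = [.sep] := by
    intro g
    have h₁ : ((C.label g).encode.filter fun a => decide (a = .sep)) = [] := by
      cases C.label g <;> simp [Label.encode]
    simp [Circuit.block, h₁]
  simp [Circuit.blocks, List.filter_flatMap, h]

theorem size_le_length_blocks : C.size ≤ C.blocks.length := by
  rw [← filter_blocks C]
  exact List.length_filter_le _ _

theorem foldlM_zeros (l : List InSym) {s : Store} (hs : s.len = syms (word L 0)) (hN : L ≤ N) :
    l.foldlM (fun s a => (addEntry a).exec N s) s =
    some { s with
      tab := List.replicate ((l.filter fun a => decide (a = .sep)).length * L) (.bit false)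
        ++ s.tab } := by
  induction l generalizing s with
  | nil => simp
  | cons a l ih =>
    by_cases ha : a = .sep
    · subst ha
      refine foldlM_cons_some (exec_loop_push (by simpa [Store.get, hs]))
        ((ih (by exact hs)).trans ?_)
      simp only [Store.set, Store.get, hs, word_zero, syms, List.map_replicate,
        List.reverse_replicate, ← List.append_assoc, List.replicate_append_replicate]
      simp [add_mul]
    · have : addEntry a = skip := by cases a <;> first | rfl | exact absurd rfl ha
      refine foldlM_cons_some (s₁ := s) (by rw [this]; rfl) ((ih hs).trans ?_)
      simp [ha]

theorem words_replicate_zero (L k : ℕ) :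
    words L (List.replicate k 0) = List.replicate (k * L) (.bit false) := by
  induction k with
  | zero => simp [words]
  | succ k ih =>
    rw [List.replicate_succ, words_cons, ih, word_zero, syms, List.map_replicate,
      List.replicate_append_replicate]
    congr 1; ring

theorem exec_evaluate (hL : 0 < L) {s : Store} (hs : RoundReady N L i p q s)
    (ht : s.tab = []) (hb : s.body = C.blocks)
    (hbN : C.blocks.length ≤ N) (hN : C.size * L ≤ N) :
    evaluate.exec N s = some { s with
      res := syms (word L ((C.stepValue fun x => if (x : ℕ) = i then q else p)^[C.blocks.length]
        0 C.output)) } := by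
  have hbd := hs.bound
  have h := foldlM_zeros (N := N) C.blocks hs.len (by omega)
  rw [filter_blocks, ← words_replicate_zero, ht, List.append_nil] at h
  -- The output gate exists, so at least one round is run and the old content of `res` is
  -- overwritten. The number of rounds is the length of the description, a convenient upper bound
  -- for the number of gates.
  have hpos : 0 < C.blocks.length := (Fin.pos C.output).trans_le (size_le_length_blocks C)
  let step := C.stepValue fun x => if (x : ℕ) = i then q else p
  refine exec_seq (exec_loop hb hbN h) <| exec_seq (s₁ := { s with
      res := syms (word L (step^[C.blocks.length] 0 C.output))
      tab := words L ((List.finRange C.size).map (step^[C.blocks.length] 0)) })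
    (exec_loop_count (fun k => { s with
      res := if k = 0 then s.res else syms (word L (step^[k] 0 C.output))
      tab := words L ((List.finRange C.size).map (step^[k] 0)) }) ?_ ?_ ?_ ?_) <|
    exec_eq (exec_clear ?_) ?_
  · simpa [Store.get, hb] using hbN
  · have : List.map (0 : Fin C.size → ℤ) (List.finRange C.size) = List.replicate C.size 0 :=
      List.eq_replicate_iff.2 ⟨by simp, by simp⟩
    simp [this]
  · simp [Store.get, hb, hpos.ne']
  · intro k hk
    refine exec_eq (exec_round C hL (step^[k] 0) ⟨⟨hs.len, hs.arg, hs.fac, hs.tmp, hs.carry,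
      hs.bound⟩, hs.idx, hs.pp, hs.qq, hs.cur, hs.acc, hs.op, hs.cmp, hs.ntab, hs.idx_le, ?_⟩ rfl
      hb hbN hN) ?_
    · simp only
      split
      · exact hs.res_le
      · simp; omega
    · simp only [Nat.add_eq_zero_iff, one_ne_zero, and_false, if_false, Function.iterate_succ_apply']
      rfl
  · simpa [Store.get, length_words] using hN
  · simp [Store.set, ht, step]

end Prog

end ShapleyCircuits

namespace ShapleyCircuits

open scoped Nat

/-! ### Preparation of the constants -/

namespace Prog

variable {N L : ℕ}

theorem exec_loop_const {k k' : Reg} {a : InSym} {s : Store} (hN : (s.get k).length ≤ N) :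
    (loop false k fun _ => push k' a).exec N s =
      some (s.set k' (List.replicate (s.get k).length a ++ s.get k')) := by
  refine exec_loop_count (fun i => s.set k' (List.replicate i a ++ s.get k')) hN (by simp) rfl ?_
  intro i _
  rw [exec_push]
  simp [List.replicate_succ]

/-- Distributes the symbols of the input to `nn` and `ntab`. -/
def parseSym (a : InSym) : Option InSym → Prog
  | some _ => push .ntab a
  | none => if a = .sep then push .carry .tick else push .nn a

/-- Splits the input. -/
def parse : Prog :=
  loop false .inp (fun a => case .carry (parseSym a)) ;; flip .ntab .body ;; clear .ntab ;;
    clear .carry ;; clear .inp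

/-- Computes the width of the digits and of the words. -/
def setDims : Prog :=
  push .mm .tick ;;
  loop false .nn (fun _ => push .mm .tick ;; push .mm .tick ;; push .mm .tick ;;
    loop false .nn fun _ => push .mm .tick) ;;
  loop false .nn (fun _ => loop false .mm (fun _ => push .len (.bit false)) ;;
    loop false .mm (fun _ => push .len (.bit false)) ;;
    loop false .mm fun _ => push .len (.bit false))

/-- Computes the values of the variables. -/
def setPowers : Prog :=
  copy .len .arg ;; push .acc (.bit true) ;; loop false .mm (fun _ => push .acc (.bit false)) ;;
  add id ;; copy .acc .pp ;; clear .acc ;; push .acc (.bit true) ;;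
  loop false .nn (fun _ => loop false .mm (fun _ => push .acc (.bit false)) ;;
    loop false .mm fun _ => push .acc (.bit false)) ;;
  add id ;; copy .acc .qq ;; clear .acc ;; clear .arg

/-- Multiplies the word in `wts` by the value of a variable. -/
def shiftWeights : Prog :=
  copy .len .arg ;; copy .wts .acc ;; loop false .mm (fun _ => push .acc (.bit false)) ;; add id

/-- Adds a multiple of `acc` to the word in `fct` and writes the result to `wts`. -/
def updateWeights : Prog :=
  copy .acc .arg ;; copy .fct .acc ;; loop false .cnt (fun _ => add id) ;; copy .acc .wts

/-- Multiplies the word in `fct` by the number in `cnt`. -/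
def updateFactorial : Prog :=
  copy .fct .arg ;; copy .len .acc ;; loop false .cnt (fun _ => add id) ;; copy .acc .fct ;;
  clear .acc ;; clear .arg

/-- The recursion step for the weights and the factorial. -/
def stepWeights : Prog :=
  push .cnt .tick ;; shiftWeights ;; updateWeights ;; updateFactorial

/-- Computes the weights and the factorial. -/
def setWeights : Prog :=
  copy .len .wts ;; const false true ;; copy .acc .fct ;; clear .acc ;;
  loop false .nn (fun _ => stepWeights) ;; clear .cnt

/-- Computes the index of the first variable to be considered. -/
def setIndex : Prog :=
  push .idx .sep ;; loop false .nn fun _ => push .idx .tick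

/-- A symbol in `carry` records that the first separator, which ends the unary `n`, has been passed.
-/
theorem foldlM_parse_body (l : List InSym) {s : Store} (hc : s.carry = [.tick]) :
    l.foldlM (fun s a => (case .carry (parseSym a)).exec N s) s =
      some { s with ntab := l.reverse ++ s.ntab } := by
  induction l generalizing s with
  | nil => rfl
  | cons a l ih =>
    refine foldlM_cons_some (s₁ := { s with ntab := a :: s.ntab }) ?_ ((ih (by exact hc)).trans ?_)
    · rw [exec, show s.get .carry = [.tick] from hc]; rfl
    · simp

theorem foldlM_parse_head (n : ℕ) {s : Store} (hc : s.carry = []) :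
    (List.replicate n InSym.tick).foldlM (fun s a => (case .carry (parseSym a)).exec N s) s =
      some { s with nn := List.replicate n .tick ++ s.nn } := by
  induction n generalizing s with
  | zero => rfl
  | succ n ih =>
    refine foldlM_cons_some (s₁ := { s with nn := .tick :: s.nn }) ?_ ((ih (by exact hc)).trans ?_)
    · rw [exec, show s.get .carry = [] from hc]; rfl
    · simp [List.replicate_succ']

theorem exec_parse {n : ℕ} (C : Circuit n) (hN : C.encode.length ≤ N) :
    parse.exec N (.init C.encode []) =
      some { Store.init [] [] with nn := List.replicate n .tick, body := C.blocks } := by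
  have hN' : n + (C.blocks.length + 1) ≤ N := by simpa [C.encode_eq] using hN
  refine exec_seq (exec_loop rfl hN (by
    rw [C.encode_eq]
    exact foldlM_append_some (foldlM_parse_head n rfl)
      (foldlM_cons_some rfl (foldlM_parse_body C.blocks rfl)))) <|
    exec_seq (exec_flip (by decide) ?_ ?_) <| exec_seq (exec_clear ?_) <|
    exec_seq (exec_clear ?_) <| exec_eq (exec_clear ?_) ?_
  · simp [Store.get, Store.set, Store.init]; omega
  · simp [Store.get, Store.set, Store.init]
  · simp [Store.get, Store.set, Store.init]; omega
  · simp [Store.get, Store.set, Store.init]; omega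
  · simp [Store.get, Store.set, Store.init, ← C.encode_eq]; omega
  · simp [Store.get, Store.set, Store.init]

/-- The width of the digits. -/
def width (n : ℕ) : ℕ :=
  n * (n + 3) + 1

/-- The width of the words. -/
def wordLen (n : ℕ) : ℕ :=
  n * (3 * width n)

theorem exec_setDims {n : ℕ} {s : Store} (hn : s.nn = List.replicate n .tick) (hm : s.mm = [])
    (hl : s.len = []) (hN : n ≤ N) (hN' : width n ≤ N) : setDims.exec N s = some { s with
      mm := List.replicate (width n) .tick
      len := syms (word (wordLen n) 0) } := by
  refine exec_seq exec_push <| exec_seq (s₁ := { s with mm := List.replicate (width n) .tick })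
    (exec_loop_count (fun k => { s with mm := List.replicate (k * (n + 3) + 1) .tick }) ?_ ?_ ?_
      ?_) <|
    exec_loop_count (fun k => { s with
      mm := List.replicate (width n) .tick
      len := List.replicate (k * (3 * width n)) (.bit false) }) ?_ ?_ ?_ ?_
  · simpa [Store.get, Store.set, hn]
  · simp [Store.get, Store.set, hm]
  · simp [Store.get, Store.set, hn, width]
  · intro i _
    refine exec_seq exec_push <| exec_seq exec_push <| exec_seq exec_push <|
      exec_eq (exec_loop_const ?_) ?_
    · simpa [Store.get, Store.set, hn]
    · simp only [Store.get, Store.set, hn, List.length_replicate, ← List.replicate_succ,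
        List.replicate_append_replicate]
      congr 2; ring
  · simpa [Store.get, hn]
  · simp [hl]
  · simp [Store.get, hn, wordLen, word_zero, syms]
  · intro i _
    refine exec_seq (exec_loop_const ?_) <| exec_seq (exec_loop_const ?_) <|
      exec_eq (exec_loop_const ?_) ?_
    · simpa [Store.get]
    · simpa [Store.get, Store.set]
    · simpa [Store.get, Store.set]
    · simp only [Store.get, Store.set, List.length_replicate, List.replicate_append_replicate]
      congr 2; ring

theorem ofBits_pow_two (k : ℕ) : ofBits (List.replicate k false ++ [true]) = 2 ^ k := by
  rw [ofBits_append, ofBits_replicate_false]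
  simp [ofBits]

theorem exec_setPowers {n m : ℕ} {s : Store} (hs : Ready N L s)
    (hn : s.nn = List.replicate n .tick) (hm : s.mm = List.replicate m .tick) (ha : s.acc = [])
    (hp : s.pp = []) (hq : s.qq = []) (hN : n * (2 * m) + 1 ≤ N) (hN' : n + m + 1 ≤ N) :
    setPowers.exec N s = some { s with
      pp := syms (word L (2 ^ m))
      qq := syms (word L (2 ^ (n * (2 * m)))) } := by
  have hb := hs.bound
  have hl := hs.len
  have harg := hs.arg
  refine exec_seq (exec_copy (by decide) ?_ ?_) <| exec_seq exec_push <|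
    exec_seq (exec_loop_const ?_) <|
    exec_seq (exec_add (x := word L 0) (r := List.replicate m false ++ [true]) id hs.len ?_ hs.tmp
      hs.carry ?_ ?_ ?_) <|
    exec_seq (exec_copy (by decide) ?_ ?_) <| exec_seq (exec_clear ?_) <| exec_seq exec_push <|
    -- The digits of `p^(2n)` are a single one preceded by `2m` zeros for each variable.
    exec_seq (s₁ := { s with
        arg := syms (word L 0)
        pp := syms (word L (2 ^ m))
        acc := syms (List.replicate (n * (2 * m)) false ++ [true]) })
      (exec_loop_count (fun k => { s with
        arg := syms (word L 0)
        pp := syms (word L (2 ^ m))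
        acc := syms (List.replicate (k * (2 * m)) false ++ [true]) }) ?_ ?_ ?_ ?_) <|
    exec_seq (exec_add (x := word L 0) (r := List.replicate (n * (2 * m)) false ++ [true]) id rfl
      rfl hs.tmp hs.carry ?_ ?_ ?_) <|
    exec_seq (exec_copy (by decide) ?_ ?_) <| exec_seq (exec_clear ?_) <|
    exec_eq (exec_clear ?_) ?_
  · simp [Store.get, hl]; omega
  · simp [Store.get, harg]
  · simp [Store.get, Store.set, hm]; omega
  · simp [Store.get, Store.set, hm, ha, syms]
  · simp; omega
  · simp; omega
  · omega
  · simp [Store.get, Store.set]; omega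
  · simp [Store.get, Store.set, hp]
  · simp [Store.get, Store.set]; omega
  · simp [Store.get, Store.set, hn]; omega
  · simp [Store.get, Store.set, syms, hl, ofBits_pow_two, word_zero, ofBits_replicate_false]
  · simp [Store.get, Store.set, hn]
  · intro i _
    refine exec_seq (exec_loop_const ?_) <| exec_eq (exec_loop_const ?_) ?_
    · simp [Store.get, hm]; omega
    · simp [Store.get, Store.set, hm]; omega
    · simp only [Store.get, Store.set, hm, List.length_replicate, syms, List.map_append,
        List.map_replicate, ← List.append_assoc, List.replicate_append_replicate]
      congr 3; ring
  · simp; omega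
  · simpa using hN
  · omega
  · simp [Store.get, Store.set]; omega
  · simp [Store.get, Store.set, hq]
  · simp [Store.get, Store.set]; omega
  · simp [Store.get, Store.set]; omega
  · simp [Store.get, Store.set, ha, harg, ofBits_pow_two, word_zero, ofBits_replicate_false]

theorem exec_loop_add {s : Store} {a b : ℤ} (ha : s.acc = syms (word L a))
    (hb : s.arg = syms (word L b)) (ht : s.tmp = []) (hc : s.carry = []) (hN : L + 2 ≤ N)
    (hN' : s.cnt.length ≤ N) : (loop false .cnt fun _ => add id).exec N s =
      some (s.set .acc (syms (word L (a + s.cnt.length * b)))) := by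
  refine exec_loop_count (fun k => { s with acc := syms (word L (a + k * b)) }) hN' ?_ rfl ?_
  · simp [← ha]
  · intro i _
    refine exec_eq (exec_add (x := word L b) (r := word L (a + i * b)) id hb rfl ht hc
      (by simp; omega) (by simp; omega) (by omega)) ?_
    rw [length_word]
    refine congrArg (fun w => { s with acc := syms w }) (word_eq_of_modEq ?_)
    have := (ofBits_word_modEq L (a + i * b)).add (ofBits_word_modEq L b)
    rw [List.map_id]
    refine this.trans (congrArg (· % _) ?_)
    push_cast; ring

/-- The weights of the coefficients, evaluated at `p`. -/
def weightSum (p : ℤ) : ℕ → ℤ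
  | 0 => 0
  | k + 1 => k ! + (k + 1) * (p * weightSum p k)

/-- Multiplication by `p = 2 ^ m` is prepending `m` low zeros. -/
theorem exec_shiftWeights {m : ℕ} {w : ℤ} {s : Store} (hs : Ready N L s)
    (hm : s.mm = List.replicate m .tick) (ha : s.acc = []) (hw : s.wts = syms (word L w))
    (hN : L + m ≤ N) : shiftWeights.exec N s = some { s with
      arg := syms (word L 0)
      acc := syms (word L (2 ^ m * w)) } := by
  have hb := hs.bound
  have hl := hs.len
  have harg := hs.arg
  refine exec_seq (exec_copy (by decide) ?_ ?_) <|
    exec_seq (exec_copy (by decide) ?_ ?_) <| exec_seq (exec_loop_const ?_) <|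
    exec_eq (exec_add (x := word L 0) (r := List.replicate m false ++ word L w) id hs.len ?_
      hs.tmp hs.carry ?_ ?_ ?_) ?_
  case refine_6 => simp [Store.get, Store.set, hw, hm, syms]
  case refine_10 =>
    have h : word L (ofBits (List.replicate m false ++ word L w) + ofBits ((word L 0).map id)) =
        word L (2 ^ m * w) := by
      refine word_eq_of_modEq ?_
      have h₁ := (ofBits_word_modEq L w).mul_left (2 ^ m)
      simpa [ofBits_append, ofBits_replicate_false, word_zero] using h₁
    rw [length_word, h]
    simp [Store.get, Store.set, hl]
  all_goals try simp [Store.get, Store.set, hl, hm, ha, hw, harg]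
  all_goals omega

theorem exec_updateWeights {a f : ℤ} {s : Store} (ha : s.acc = syms (word L a))
    (hf : s.fct = syms (word L f)) (ht : s.tmp = []) (hc : s.carry = [])
    (hg : s.arg.length ≤ N) (hw : s.wts.length ≤ N) (hN : L + 2 ≤ N) (hN' : s.cnt.length ≤ N) :
    updateWeights.exec N s = some { s with
      arg := syms (word L a)
      acc := syms (word L (f + s.cnt.length * a))
      wts := syms (word L (f + s.cnt.length * a)) } := by
  refine exec_seq (exec_copy (by decide) ?_ ?_) <| exec_seq (exec_copy (by decide) ?_ ?_) <|
    exec_seq (exec_loop_add (L := L) (a := f) (b := a) hf ha ht hc hN hN') <|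
    exec_eq (exec_copy (by decide) ?_ ?_) ?_
  all_goals simp [Store.get, Store.set, ha, hf, hg, hw]
  all_goals omega

theorem exec_updateFactorial {f : ℤ} {s : Store} (hl : s.len = syms (word L 0))
    (hf : s.fct = syms (word L f)) (ht : s.tmp = []) (hc : s.carry = [])
    (hg : s.arg.length ≤ N) (ha : s.acc.length ≤ N) (hN : L + 2 ≤ N) (hN' : s.cnt.length ≤ N) :
    updateFactorial.exec N s = some { s with
      arg := []
      acc := []
      fct := syms (word L (s.cnt.length * f)) } := by
  refine exec_seq (exec_copy (by decide) ?_ ?_) <| exec_seq (exec_copy (by decide) ?_ ?_) <|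
    exec_seq (exec_loop_add (L := L) (a := 0) (b := f) hl hf ht hc hN hN') <|
    exec_seq (exec_copy (by decide) ?_ ?_) <| exec_seq (exec_clear ?_) <|
    exec_eq (exec_clear ?_) ?_
  all_goals simp [Store.get, Store.set, hf, hg, ha, hl]
  all_goals omega

/-- The counter is raised to `k + 1` first and serves as the multiplier in both recursions; the
weights are updated while `fct` still holds `k !`. Multiplication by the counter is repeated
addition. -/
theorem exec_stepWeights {m k : ℕ} {s : Store} (hs : Ready N L s)
    (hm : s.mm = List.replicate m .tick) (ha : s.acc = [])
    (hc : s.cnt = List.replicate k .tick) (hw : s.wts = syms (word L (weightSum (2 ^ m) k)))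
    (hf : s.fct = syms (word L (k !))) (hN : L + m ≤ N) (hN' : k + 1 ≤ N) :
    stepWeights.exec N s = some { s with
      cnt := List.replicate (k + 1) .tick
      wts := syms (word L (weightSum (2 ^ m) (k + 1)))
      fct := syms (word L ((k + 1)!)) } := by
  have hb := hs.bound
  have harg := hs.arg
  have hcl : (InSym.tick :: s.cnt).length = k + 1 := by simp [hc]
  refine exec_seq (s₁ := { s with cnt := .tick :: s.cnt }) exec_push <|
    exec_seq (exec_shiftWeights (L := L) (m := m) (w := weightSum (2 ^ m) k)
      ⟨hs.len, hs.arg, hs.fac, hs.tmp, hs.carry, hs.bound⟩ hm ha hw hN) <|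
    exec_seq (exec_updateWeights (L := L) rfl hf hs.tmp hs.carry (by simp; omega)
      (by simp [hw]; omega) hb (by rw [hcl]; omega)) <|
    exec_eq (exec_updateFactorial (L := L) hs.len hf hs.tmp hs.carry (by simp; omega)
      (by simp; omega) hb (by rw [hcl]; omega)) ?_
  simp [hc, ha, harg, List.replicate_succ, weightSum, Nat.factorial_succ]

theorem exec_setWeights {n m : ℕ} {s : Store} (hs : Ready N L s)
    (hn : s.nn = List.replicate n .tick) (hm : s.mm = List.replicate m .tick) (ha : s.acc = [])
    (hc : s.cnt = []) (hw : s.wts = []) (hf : s.fct = []) (hN : L + m ≤ N) (hN' : n + 1 ≤ N) :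
    setWeights.exec N s = some { s with
      wts := syms (word L (weightSum (2 ^ m) n))
      fct := syms (word L (n !)) } := by
  have hb := hs.bound
  have hl := hs.len
  refine exec_seq (exec_copy (by decide) ?_ ?_) <|
    exec_seq (exec_const false true hs.len hs.tmp hs.carry ?_ ?_ ?_ hs.arg) <|
    exec_seq (exec_copy (by decide) ?_ ?_) <| exec_seq (exec_clear ?_) <|
    exec_seq (s₁ := { s with
      cnt := List.replicate n .tick
      wts := syms (word L (weightSum (2 ^ m) n))
      fct := syms (word L (n !)) }) (exec_loop_count (fun k => { s with
      cnt := List.replicate k .tick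
      wts := syms (word L (weightSum (2 ^ m) k))
      fct := syms (word L (k !)) }) ?_ ?_ ?_ ?_) <| exec_eq (exec_clear ?_) ?_
  case refine_12 =>
    intro k hk
    simp only [Store.get, Store.set, hn, List.length_replicate] at hk
    exact exec_stepWeights ⟨hs.len, hs.arg, hs.fac, hs.tmp, hs.carry, hs.bound⟩ hm ha rfl rfl rfl
      hN (by omega)
  all_goals try simp [Store.get, Store.set, hl, hn, ha, hc, hw, hf, weightSum]
  all_goals omega

theorem exec_setIndex {n : ℕ} {s : Store} (hn : s.nn = List.replicate n .tick) (hi : s.idx = [])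
    (hN : n ≤ N) :
    setIndex.exec N s = some { s with idx := List.replicate n .tick ++ [.sep] } := by
  refine exec_seq exec_push <| exec_eq (exec_loop_const ?_) ?_
  · simpa [Store.get, Store.set, hn]
  · simp [Store.get, Store.set, hn, hi]

end Prog

end ShapleyCircuits

namespace ShapleyCircuits

open scoped Nat

/-! ### Output of fractions -/

/-- `Nat.bits` has no zeros at the most significant end, so those of a fixed-width word must be
stripped before output. -/
theorem bits_ofBits (x : List Bool) :
    (x.reverse.dropWhile not).reverse = (ofBits x).toNat.bits := by
  induction x with
  | nil => simp [ofBits]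
  | cons b x ih =>
    have h₀ := ofBits_nonneg x
    have e : (ofBits (b :: x)).toNat = Nat.bit b (ofBits x).toNat := by
      rw [ofBits, Nat.bit_val]
      cases b <;> simp <;> omega
    rw [e, List.reverse_cons, List.dropWhile_append]
    by_cases hx : (ofBits x).toNat = 0
    · have hd : x.reverse.dropWhile not = [] := by
        rw [hx, Nat.zero_bits] at ih
        exact List.reverse_eq_nil_iff.1 ih
      rw [hd, hx]
      cases b <;> simp
    · have hd : x.reverse.dropWhile not ≠ [] := by
        intro h
        rw [h] at ih
        have := congrArg List.length ih
        rw [Nat.size_eq_bits_len] at this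
        exact hx (Nat.size_eq_zero.1 this.symm)
      rw [Nat.bits_append_bit _ _ (fun h => absurd h hx), ← ih]
      simp [hd]

theorem ofBits_word_of_lt {m k : ℕ} (h : k < 2 ^ m) : ofBits (word m k) = k := by
  have h₁ := ofBits_word_modEq m k
  have h₂ := ofBits_lt (word m k)
  rw [length_word] at h₂
  rwa [Int.ModEq, Int.emod_eq_of_lt (ofBits_nonneg _) h₂,
    Int.emod_eq_of_lt (by positivity) (by exact_mod_cast h)] at h₁

theorem bits_word {m k : ℕ} (h : k < 2 ^ m) :
    ((word m k).reverse.dropWhile not).reverse = k.bits := by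
  rw [bits_ofBits, ofBits_word_of_lt h, Int.toNat_natCast]

theorem drop_word {L k : ℕ} (h : k ≤ L) (z : ℤ) :
    (word L z).drop k = word (L - k) (z / 2 ^ k) := by
  induction k generalizing L z with
  | zero => simp
  | succ k ih =>
    obtain ⟨L, rfl⟩ := Nat.exists_eq_succ_of_ne_zero (by omega : L ≠ 0)
    rw [word, List.drop_succ_cons, ih (by omega), Nat.succ_sub_succ, pow_succ',
      Int.ediv_ediv_of_nonneg (by norm_num)]

theorem reverse_word {L k : ℕ} (h : k ≤ L) (z : ℤ) :
    (word L z).reverse = (word k (z / 2 ^ (L - k))).reverse ++ ((word L z).take (L - k)).reverse := by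
  rw [← List.reverse_append]
  conv_lhs => rw [← List.take_append_drop (L - k) (word L z), drop_word (by omega)]
  congr 4
  omega

theorem word_pow_two {L m : ℕ} (h : m < L) :
    word L (2 ^ m) = List.replicate m false ++ true :: List.replicate (L - 1 - m) false := by
  have := word_ofBits (List.replicate m false ++ true :: List.replicate (L - 1 - m) false)
  rw [ofBits_append, ofBits_replicate_false, ofBits, ofBits_replicate_false] at this
  simp only [List.length_append, List.length_replicate, List.length_cons] at this
  rw [← this]
  congr 1
  · omega
  · simp

/-- Reversing the stored word of `p = 2 ^ m` gives half of `2 ^ (L - m)`, the place value of the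
wanted digit. This is the rounding constant, obtained without further computation. -/
theorem ofBits_reverse_word_pow_two {L m : ℕ} (h : m < L) :
    ofBits (word L (2 ^ m)).reverse = 2 ^ (L - 1 - m) := by
  rw [word_pow_two h, List.reverse_append, List.reverse_cons, List.reverse_replicate,
    List.reverse_replicate, ofBits_append, ofBits_replicate_false, List.length_append,
    ofBits_append, ofBits_replicate_false]
  simp [ofBits]

namespace Prog

variable {N L : ℕ}

/-- Computes the word that holds the numerator and writes its reversal to `fac`. -/
def product : Prog :=
  flip .wts .fac ;; copy .res .arg ;; mul ;; flip .pp .arg ;; add id ;; flip .acc .fac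

/-- Replaces a negative number by its absolute value. -/
def negate : Prog :=
  push .op .tick ;; copy .acc .arg ;; flip .pp .acc ;; push .acc (.bit false) ;; add not

/-- Replaces the numerator by its absolute value if its leading digit is `1`. -/
def fixSign : Option InSym → Prog
  | some (.bit true) => negate
  | _ => skip

/-- Outputs a digit, unless it is a leading zero. -/
def emitDigit : Option InSym → Prog
  | some (.bit true) => pop .fac ;; clear .carry ;; push .carry .tick ;; emit (.bit true)
  | some (.bit false) => pop .fac ;; case .carry fun
    | some _ => emit (.bit false)
    | none => skip
  | _ => skip

/-- Outputs the number whose digits are on top of `fac`, most significant digit first. -/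
def emitBits (k : Reg) : Prog :=
  loop false k (fun _ => case .fac emitDigit) ;; clear .carry

/-- Outputs a fraction. -/
def emitFraction : Prog :=
  emit .sep ;; flip .fct .fac ;; emitBits .len ;; emit .slash ;; flip .acc .fac ;; emitBits .mm ;;
  (case .op fun
    | some _ => emit .minus
    | none => skip)

/-- Outputs a Shapley value. -/
def output : Prog :=
  product ;; case .fac fixSign ;; clear .arg ;; emitFraction ;;
  clear .op ;; clear .fac ;; clear .acc ;; clear .res

/-- The flag `b`, kept in `carry`, tells whether a digit one has already been seen; until then zeros
are suppressed. -/
theorem foldlM_emitDigit (c : List InSym) (l : List Bool) (hl : l.length = c.length) (b : Bool)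
    (rest : List InSym) (o : List OutSym) (s : Store) (hN : 1 ≤ N) : ∃ b' : Bool,
    c.foldlM (fun s _ => (case .fac emitDigit).exec N s) { s with
      fac := syms l ++ rest
      carry := if b then [.tick] else []
      out := o } = some { s with
        fac := rest
        carry := if b' then [.tick] else []
        out := (if b then l else l.dropWhile not).reverse.map .bit ++ o } := by
  induction c generalizing l b o with
  | nil =>
    obtain rfl := List.length_eq_zero_iff.1 hl
    exact ⟨b, by simp [syms]⟩
  | cons _ c ih =>
    obtain ⟨a, l, rfl⟩ := List.exists_cons_of_length_eq_add_one hl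
    simp only [List.length_cons, add_left_inj] at hl
    cases a with
    | true =>
      obtain ⟨b', h⟩ := ih l hl true (.bit true :: o)
      refine ⟨b', foldlM_cons_some (s₁ := { s with
        fac := syms l ++ rest
        carry := [.tick]
        out := .bit true :: o }) ?_ (h.trans ?_)⟩
      · refine exec_seq (P := pop .fac) rfl <| exec_seq (exec_clear ?_) <| exec_seq exec_push rfl
        cases b <;> simp [Store.get, Store.set, hN]
      · simp
    | false =>
      cases b with
      | true =>
        obtain ⟨b', h⟩ := ih l hl true (.bit false :: o)
        refine ⟨b', foldlM_cons_some rfl (h.trans ?_)⟩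
        simp
      | false =>
        obtain ⟨b', h⟩ := ih l hl false o
        refine ⟨b', foldlM_cons_some rfl (h.trans ?_)⟩
        simp

theorem exec_emitBits {k : Reg} {l : List Bool} {rest : List InSym} {s : Store}
    (hk : (s.get k).length = l.length) (hf : s.fac = syms l ++ rest) (hc : s.carry = [])
    (hN : 1 ≤ N) (hN' : l.length ≤ N) : (emitBits k).exec N s = some { s with
      fac := rest
      out := (l.dropWhile not).reverse.map .bit ++ s.out } := by
  obtain ⟨b', h⟩ := foldlM_emitDigit (s.get k) l hk.symm false rest s.out s hN
  have hs : s = { s with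
      fac := syms l ++ rest
      carry := if false then [.tick] else []
      out := s.out } := by
    cases s; simp_all
  rw [← hs] at h
  refine exec_seq (exec_loop rfl (by omega) h) (exec_eq (exec_clear ?_) ?_)
  · cases b' <;> simp [Store.get, hN]
  · simp [Store.set, hc]

theorem exec_product {p e w : ℤ} {s : Store} (hs : Ready N L s) (ha : s.acc = [])
    (hp : s.pp = syms (word L p)) (hr : s.res = syms (word L e)) (hw : s.wts = syms (word L w)) :
    product.exec N s = some { s with
      arg := syms (word L p).reverse
      acc := syms (word L (e * w + ofBits (word L p).reverse))
      fac := syms (word L (e * w + ofBits (word L p).reverse)).reverse } := by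
  have hb := hs.bound
  have hl := hs.len
  have harg := hs.arg
  have hfac := hs.fac
  have h : word L (ofBits (word L (e * w)) + ofBits ((word L p).reverse.map id)) =
      word L (e * w + ofBits (word L p).reverse) := by
    rw [List.map_id]
    exact word_eq_of_modEq ((ofBits_word_modEq L _).add_right _)
  refine exec_seq (exec_flip (by decide) ?_ ?_) <| exec_seq (exec_copy (by decide) ?_ ?_) <|
    exec_seq (exec_mul (L := L) (a := e) (b := w) hr ?_ hs.len hs.tmp hs.carry ?_ ?_) <|
    exec_seq (exec_flip (by decide) ?_ ?_) <|
    exec_seq (exec_add (x := (word L p).reverse) (r := word L (e * w)) id ?_ ?_ hs.tmp hs.carry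
      ?_ ?_ ?_) <|
    exec_eq (exec_flip (by decide) ?_ ?_) ?_
  case refine_17 =>
    rw [List.length_reverse, length_word, h]
    simp [Store.get, Store.set, hp, reverse_syms]
  all_goals try simp [Store.get, Store.set, hl, hr, hp, hw, ha, hfac, harg, reverse_syms]
  all_goals omega

/-- For `p = 2 ^ m` and `Q = 2 ^ (L - m)` this replaces `y` by `Q - 1 - y`. It negates the quotient
by `Q` exactly and sends the remainder `r` to `Q - 1 - r`, so no borrow disturbs the leading digits.
-/
theorem exec_negate {p y : ℤ} {s : Store} (hp : s.pp = syms (word L p))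
    (ha : s.acc = syms (word L y)) (ho : s.op = []) (hg : s.arg.length ≤ N) (ht : s.tmp = [])
    (hc : s.carry = []) (hN : L + 2 ≤ N) : negate.exec N s = some { s with
      op := [.tick]
      arg := syms (word L y)
      acc := syms (word L (2 * ofBits (word L p).reverse + (-1 - y))) } := by
  refine exec_seq exec_push <| exec_seq (exec_copy (by decide) ?_ ?_) <|
    exec_seq (exec_flip (by decide) ?_ ?_) <| exec_seq exec_push <|
    exec_eq (exec_add (x := word L y) (r := false :: (word L p).reverse) not ha ?_ ht hc
      ?_ ?_ ?_) ?_
  case refine_9 =>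
    rw [length_word, word_eq_of_modEq ((ofBits_map_not_word_modEq L y).add_left _)]
    simp [Store.get, Store.set, ha, ho, ofBits]
  all_goals try simp [Store.get, Store.set, hp, ha, hg, syms]
  all_goals omega

/-- The output is a stack, so a fraction is emitted backwards: terminator first, most significant
digits before lower ones, sign last. The numerator is the top `m` digits of `y`; the low digits
remain in `fac` as `f`. -/
theorem exec_emitFraction {m d : ℕ} {v y : ℤ} {s : Store} (hs : Ready N L { s with fac := [] })
    (hm : s.mm = List.replicate m .tick) (hf : s.fct = syms (word L d))
    (ha : s.acc = syms (word L y)) (hy : word m (y / 2 ^ (L - m)) = word m v.natAbs)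
    (ho : s.op = if v < 0 then [.tick] else []) (hd : d < 2 ^ L) (hv : v.natAbs < 2 ^ m)
    (hfac : s.fac.length ≤ N) (hmL : m ≤ L) : ∃ f, f.length ≤ N ∧
      emitFraction.exec N s = some { s with
        fac := f
        out := encodeFraction (v, d) ++ s.out } := by
  have hb := hs.bound
  have hl : s.len = syms (word L 0) := hs.len
  refine ⟨syms ((word L y).take (L - m)).reverse, by simp; omega, ?_⟩
  refine exec_seq (P := emit .sep) rfl <| exec_seq (exec_flip (by decide) ?_ ?_) <|
    exec_seq (exec_emitBits (l := (word L d).reverse) (rest := []) ?_ ?_ hs.carry ?_ ?_) <|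
    exec_seq (P := emit .slash) rfl <| exec_seq (exec_flip (by decide) ?_ ?_) <|
    exec_seq (exec_emitBits (l := (word m v.natAbs).reverse)
      (rest := syms ((word L y).take (L - m)).reverse) ?_ ?_ hs.carry ?_ ?_) ?_
  case refine_13 =>
    rw [exec, bits_word hd, bits_word hv]
    simp only [Store.get, Store.set, ho]
    by_cases h : v < 0 <;>
      simp [h, exec, encodeFraction]
  case refine_10 =>
    simp only [Store.get, Store.set, ha, reverse_syms]
    rw [reverse_word hmL, hy]
    simp [syms]
  all_goals try simp [Store.get, Store.set, hf, ha, hm, hl, reverse_syms]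
  all_goals omega

/-- By `hlo` the product is within half a unit of a multiple of `2 ^ (L - m)`, so adding that half
and dropping the low digits rounds to `v + 2 ^ m * k`. Its last `m` digits are the two's complement
of `v`, and `hv` makes the leading one the sign. -/
theorem exec_output {m d : ℕ} {e w v k : ℤ} {s : Store} (hs : Ready N L s) (ha : s.acc = [])
    (ho : s.op = []) (hm : s.mm = List.replicate m .tick)
    (hp : s.pp = syms (word L (2 ^ m))) (hr : s.res = syms (word L e))
    (hw : s.wts = syms (word L w)) (hf : s.fct = syms (word L d)) (hd : d < 2 ^ L)
    (hmL : m < L) (hm₀ : 0 < m) (hv : 2 * |v| < 2 ^ m)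
    (hlo : 2 * |e * w - 2 ^ (L - m) * (v + 2 ^ m * k)| < 2 ^ (L - m)) :
    output.exec N s = some { s with
      res := []
      out := encodeFraction (v, d) ++ s.out } := by
  have hb := hs.bound
  have harg := hs.arg
  have hfac := hs.fac
  set y := e * w + ofBits (word L (2 ^ m)).reverse with hy
  have hQ : (2 : ℤ) ^ (L - m) = 2 * ofBits (word L (2 ^ m)).reverse := by
    rw [ofBits_reverse_word_pow_two hmL, ← pow_succ']
    congr 1; omega
  have hyQ : y / 2 ^ (L - m) = v + 2 ^ m * k := by
    have h₁ := le_abs_self (e * w - 2 ^ (L - m) * (v + 2 ^ m * k))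
    have h₂ := neg_abs_le (e * w - 2 ^ (L - m) * (v + 2 ^ m * k))
    exact ((Int.ediv_emod_unique (by positivity)).2
      ⟨(by ring : (y - 2 ^ (L - m) * (v + 2 ^ m * k)) + _ = y), by linarith, by linarith⟩).1
  have hword : word m (v + 2 ^ m * k) = word m v :=
    word_eq_of_modEq (Int.modEq_iff_dvd.2 ⟨-k, by ring⟩)
  have hm₁ : (2 : ℤ) ^ m = 2 * 2 ^ (m - 1) := by
    rw [← pow_succ']
    congr 1; omega
  have hv₁ := le_abs_self v
  have hv₂ := neg_abs_le v
  have hhead : (syms (word L y).reverse).head? = some (.bit (decide (v < 0))) := by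
    rw [reverse_word hmL.le, hyQ, hword, reverse_word hm₀]
    have h : v / 2 ^ (m - 1) = if v < 0 then -1 else 0 := by
      split
      · exact ((Int.ediv_emod_unique (by positivity)).2
          ⟨(by ring : (v + 2 ^ (m - 1)) + 2 ^ (m - 1) * (-1) = v), by linarith, by linarith⟩).1
      · exact Int.ediv_eq_zero_of_lt (by omega) (by linarith)
    rw [h]
    by_cases hv₀ : v < 0 <;> simp [hv₀, word, syms]
  have hpr := exec_product hs ha hp hr hw
  rw [← hy] at hpr
  obtain ⟨g, y', hg, hy', hsign⟩ : ∃ (g : List InSym) (y' : ℤ), g.length ≤ N ∧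
      word m (y' / 2 ^ (L - m)) = word m v.natAbs ∧
      (case .fac fixSign).exec N { s with
        arg := syms (word L (2 ^ m)).reverse
        acc := syms (word L y)
        fac := syms (word L y).reverse } = some { s with
        arg := g
        acc := syms (word L y')
        op := if v < 0 then [.tick] else []
        fac := syms (word L y).reverse } := by
    rw [exec, show Store.get { s with
        arg := syms (word L (2 ^ m)).reverse
        acc := syms (word L y)
        fac := syms (word L y).reverse } .fac = syms (word L y).reverse from rfl, hhead]
    by_cases hv₀ : v < 0
    · refine ⟨syms (word L y), 2 * ofBits (word L (2 ^ m)).reverse + (-1 - y), by simp; omega,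
        ?_, ?_⟩
      · rw [← hQ]
        have : (2 ^ (L - m) + (-1 - y)) / 2 ^ (L - m) = -(v + 2 ^ m * k) := by
          have h₁ := Int.emod_add_mul_ediv y (2 ^ (L - m))
          have h₂ := Int.emod_nonneg y (by positivity : (2 : ℤ) ^ (L - m) ≠ 0)
          have h₃ := Int.emod_lt_of_pos y (by positivity : (0 : ℤ) < 2 ^ (L - m))
          rw [hyQ] at h₁
          exact ((Int.ediv_emod_unique (by positivity)).2
            ⟨(by linarith : (2 ^ (L - m) - 1 - y % 2 ^ (L - m)) +
              2 ^ (L - m) * (-(v + 2 ^ m * k)) = _), by linarith, by linarith⟩).1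
        rw [this]
        refine word_eq_of_modEq (Int.modEq_iff_dvd.2 ⟨k, ?_⟩)
        rw [Int.natCast_natAbs, abs_of_neg hv₀]; ring
      · simp only [hv₀, decide_true, if_true]
        exact exec_negate hp rfl ho (by simp; omega) hs.tmp hs.carry hb
    · refine ⟨syms (word L (2 ^ m)).reverse, y, by simp; omega, ?_, ?_⟩
      · rw [hyQ, hword, Int.natCast_natAbs, abs_of_nonneg (by omega)]
      · simp [hv₀, fixSign, exec, ho]
  obtain ⟨f, hf', hem⟩ := exec_emitFraction (N := N) (L := L) (m := m) (d := d) (v := v) (y := y')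
    (s := { s with
        arg := []
        acc := syms (word L y')
        op := if v < 0 then [.tick] else []
        fac := syms (word L y).reverse })
    ⟨hs.len, rfl, rfl, hs.tmp, hs.carry, hs.bound⟩ hm hf rfl hy' rfl hd (by zify; linarith)
    (by simp; omega) hmL.le
  refine exec_seq hpr <| exec_seq hsign <| exec_seq (exec_clear hg) <| exec_seq hem <|
    exec_seq (exec_clear ?_) <| exec_seq (exec_clear ?_) <| exec_seq (exec_clear ?_) <|
    exec_eq (exec_clear ?_) ?_
  · simp only [Store.get]; split <;> simp; omega
  · simpa [Store.get, Store.set]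
  · simp [Store.get, Store.set]; omega
  · simp [Store.get, Store.set, hr]; omega
  · simp [Store.set, harg, hfac, ha, ho]

end Prog

end ShapleyCircuits

namespace ShapleyCircuits

open scoped Nat

namespace Prog

/-! ### The program for Shapley values -/

/-- Empties the registers that hold constants. -/
def cleanup : Prog :=
  clear .nn ;; clear .body ;; clear .mm ;; clear .len ;; clear .idx ;; clear .pp ;; clear .qq ;;
  clear .wts ;; clear .fct

/-- Prepares the constants. -/
def setup : Prog :=
  parse ;; setDims ;; setPowers ;; setWeights ;; setIndex

/-- Computes the Shapley values. -/
def shapley : Prog :=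
  setup ;; loop false .nn (fun _ => pop .idx ;; evaluate ;; output) ;; cleanup

variable {N n : ℕ} (C : Circuit n)

/-- The registers before the Shapley value of a variable is computed, where `j` is the number of the
remaining variables and `o` is the output. -/
def mainStore (j : ℕ) (o : List OutSym) : Store :=
  { Store.init [] o with
    nn := List.replicate n .tick
    body := C.blocks
    mm := List.replicate (width n) .tick
    len := syms (word (wordLen n) 0)
    pp := syms (word (wordLen n) (2 ^ width n))
    qq := syms (word (wordLen n) (2 ^ (n * (2 * width n))))
    wts := syms (word (wordLen n) (weightSum (2 ^ width n) n))
    fct := syms (word (wordLen n) (n !))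
    idx := List.replicate j .tick ++ [.sep] }

theorem exec_setup (h₁ : C.encode.length ≤ N) (h₂ : wordLen n + width n + n + 2 ≤ N) :
    setup.exec N (.init C.encode []) = some (mainStore C n []) := by
  have hw : n * (2 * width n) ≤ wordLen n := Nat.mul_le_mul_left n (by omega)
  exact exec_seq (exec_parse C h₁) <|
    exec_seq (exec_setDims rfl rfl rfl (by omega) (by omega)) <|
    exec_seq (exec_setPowers ⟨rfl, rfl, rfl, rfl, rfl, by omega⟩ rfl rfl rfl rfl rfl (by omega)
      (by omega)) <|
    exec_seq (exec_setWeights ⟨rfl, rfl, rfl, rfl, rfl, by omega⟩ rfl rfl rfl rfl rfl rfl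
      (by omega) (by omega)) <|
    exec_setIndex rfl rfl (by omega)

theorem exec_cleanup (o : List OutSym) (h₁ : C.encode.length ≤ N)
    (h₂ : wordLen n + width n + n + 2 ≤ N) :
    cleanup.exec N (mainStore C 0 o) = some (.init [] o) := by
  have hN : n + (C.blocks.length + 1) ≤ N := by simpa [C.encode_eq] using h₁
  refine exec_seq (exec_clear ?_) <| exec_seq (exec_clear ?_) <| exec_seq (exec_clear ?_) <|
    exec_seq (exec_clear ?_) <| exec_seq (exec_clear ?_) <| exec_seq (exec_clear ?_) <|
    exec_seq (exec_clear ?_) <| exec_seq (exec_clear ?_) <| exec_eq (exec_clear ?_) rfl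
  all_goals simp [Store.get, Store.set, mainStore]
  all_goals omega

/-- The value that the program computes for the output gate. -/
def outputValue (i : ℕ) : ℤ :=
  (C.stepValue fun x =>
    if (x : ℕ) = i then 2 ^ (n * (2 * width n)) else 2 ^ width n)^[C.blocks.length] 0 C.output

theorem exec_shapley (v : Fin n → ℤ) (hv : ∀ i, 2 * |v i| < 2 ^ width n)
    (hlo : ∀ i : Fin n, ∃ k, 2 * |outputValue C i * weightSum (2 ^ width n) n -
      2 ^ (wordLen n - width n) * (v i + 2 ^ width n * k)| < 2 ^ (wordLen n - width n))
    (hd : n ! < 2 ^ width n)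
    (h₁ : C.encode.length ≤ N) (h₂ : wordLen n + width n + n + 2 ≤ N)
    (h₃ : C.size * wordLen n ≤ N) :
    shapley.exec N (.init C.encode []) =
      some (.init [] (encodeFractions (List.ofFn fun i => (v i, n !)))) := by
  have hN : n + (C.blocks.length + 1) ≤ N := by simpa [C.encode_eq] using h₁
  set fr := List.ofFn fun i => (v i, n !) with hfr
  refine exec_seq (exec_setup C h₁ h₂) <| exec_seq (exec_loop_count
    -- Variables are treated from the last to the first, as output is pushed on top; after `k`
    -- iterations the last `k` fractions are present.
    (fun k => mainStore C (n - k) (encodeFractions (fr.drop (n - k)))) ?_ ?_ rfl ?_) ?_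
  · simp [Store.get, mainStore]; omega
  · have : fr.drop (n - 0) = [] := List.drop_eq_nil_of_le (by simp [hfr])
    show mainStore C (n - 0) (encodeFractions (fr.drop (n - 0))) = _
    rw [this]
    rfl
  · intro k hk
    obtain ⟨j, hj⟩ : ∃ j, n - k = j + 1 := ⟨n - k - 1, by
      simp [Store.get, mainStore] at hk; omega⟩
    have hjn : j < n := by omega
    have hw : 0 < width n := Nat.succ_pos _
    -- This fails for `n = 0`, but inside the loop there is a variable `j < n`.
    have hL : width n < wordLen n := by
      have : 1 * (3 * width n) ≤ wordLen n := Nat.mul_le_mul_right _ (by omega)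
      omega
    rw [hj, show n - (k + 1) = j by omega]
    obtain ⟨q, hq⟩ := hlo ⟨j, hjn⟩
    refine exec_seq (s₁ := mainStore C j (encodeFractions (fr.drop (j + 1)))) rfl <|
      exec_seq (exec_evaluate C (i := j) (L := wordLen n) (p := 2 ^ width n)
        (q := 2 ^ (n * (2 * width n))) (by omega)
        ⟨⟨rfl, rfl, rfl, rfl, rfl, by omega⟩, rfl, rfl, rfl, rfl, rfl, rfl, rfl, rfl, by omega,
          Nat.zero_le _⟩ rfl rfl (by omega) h₃) <|
      exec_eq (exec_output (m := width n) (d := n !) (L := wordLen n)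
        ⟨rfl, rfl, rfl, rfl, rfl, by omega⟩ rfl rfl rfl rfl rfl rfl rfl
        (hd.trans_le (Nat.pow_le_pow_right (by norm_num) hL.le)) hL hw (hv ⟨j, hjn⟩) hq) ?_
    have : fr.drop j = (v ⟨j, hjn⟩, n !) :: fr.drop (j + 1) := by
      rw [List.drop_eq_getElem_cons (by simpa [hfr] using hjn)]
      simp [hfr]
    have hE : encodeFractions (fr.drop j) =
        encodeFraction (v ⟨j, hjn⟩, n !) ++ encodeFractions (fr.drop (j + 1)) := by
      rw [this]
      rfl
    rw [hE]
    rfl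
  · have : (Store.get (mainStore C n []) .nn).length = n := by simp [Store.get, mainStore]
    rw [this, Nat.sub_self, List.drop_zero]
    exact exec_cleanup C _ h₁ h₂

end Prog

end ShapleyCircuits

namespace ShapleyCircuits

/-! ### Multilinear extensions -/

/-- The weight of a valuation if the variable `X_j` is true with the weight `x j`, and false with the
weight `1 - x j`. -/
def valuationWeight {n : ℕ} (x : Fin n → ℤ) (θ : Fin n → Bool) : ℤ :=
  ∏ j, if θ j then x j else 1 - x j

/-- The multilinear extension of a function on valuations. -/
def extension {n : ℕ} (f : (Fin n → Bool) → ℤ) (x : Fin n → ℤ) : ℤ :=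
  ∑ θ, f θ * valuationWeight x θ

section Extension

variable {n : ℕ} (x : Fin n → ℤ)

/-- Expand the product of the factors `x j + (1 - x j)`. The identity is formal: the weights need
not be probabilities. -/
theorem sum_valuationWeight : ∑ θ, valuationWeight x θ = 1 := by
  have := Finset.prod_univ_sum (fun _ : Fin n => (Finset.univ : Finset Bool))
    (fun j b => if b then x j else 1 - x j)
  rw [Fintype.piFinset_univ] at this
  simp only [valuationWeight]
  rw [← this]
  simp

theorem extension_const (c : ℤ) : extension (fun _ => c) x = c := by
  simp [extension, ← Finset.mul_sum, sum_valuationWeight]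

theorem extension_sub (f g : (Fin n → Bool) → ℤ) :
    extension (fun θ => f θ - g θ) x = extension f x - extension g x := by
  simp [extension, sub_mul, Finset.sum_sub_distrib]

theorem extension_sum {ι : Type*} (s : Finset ι) (f : ι → (Fin n → Bool) → ℤ) :
    extension (fun θ => ∑ i ∈ s, f i θ) x = ∑ i ∈ s, extension (f i) x := by
  simp only [extension, Finset.sum_mul]
  exact Finset.sum_comm

/-- Extensions of functions of disjoint sets of variables are multiplicative: exchanging the
variables outside of `s` between two valuations preserves the product of their weights. -/
theorem extension_mul {f g : (Fin n → Bool) → ℤ} {s t : Set (Fin n)} (hf : DependsOn f s)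
    (hg : DependsOn g t) (hst : Disjoint s t) :
    extension (f * g) x = extension f x * extension g x := by
  classical
  let e : (Fin n → Bool) × (Fin n → Bool) → (Fin n → Bool) × (Fin n → Bool) := fun p =>
    (fun j => if j ∈ s then p.1 j else p.2 j, fun j => if j ∈ s then p.2 j else p.1 j)
  have he : Function.Involutive e := by
    rintro ⟨θ, η⟩
    ext j <;> by_cases h : j ∈ s <;> simp [e, h]
  have hw : ∀ p, valuationWeight x (e p).1 * valuationWeight x (e p).2 =
      valuationWeight x p.1 * valuationWeight x p.2 := by
    rintro ⟨θ, η⟩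
    simp only [valuationWeight, ← Finset.prod_mul_distrib]
    refine Finset.prod_congr rfl fun j _ => ?_
    by_cases h : j ∈ s <;> simp [e, h, mul_comm]
  calc extension (f * g) x
      = extension (f * g) x * ∑ θ, valuationWeight x θ := by rw [sum_valuationWeight, mul_one]
    _ = ∑ p : (Fin n → Bool) × (Fin n → Bool),
          f p.1 * g p.1 * (valuationWeight x p.1 * valuationWeight x p.2) := by
        rw [extension, Finset.sum_mul_sum, ← Finset.sum_product', Finset.univ_product_univ]
        exact Finset.sum_congr rfl fun p _ => mul_assoc _ _ _
    _ = ∑ p : (Fin n → Bool) × (Fin n → Bool),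
          f (e p).1 * g (e p).1 * (valuationWeight x (e p).1 * valuationWeight x (e p).2) :=
        (he.toPerm.sum_comp _ (fun p : (Fin n → Bool) × (Fin n → Bool) =>
          f p.1 * g p.1 * (valuationWeight x p.1 * valuationWeight x p.2)) (by simp)).symm
    _ = ∑ p : (Fin n → Bool) × (Fin n → Bool),
          f p.1 * g p.2 * (valuationWeight x p.1 * valuationWeight x p.2) := by
        refine Finset.sum_congr rfl fun p _ => ?_
        rw [hw, hf (y := p.1), hg (y := p.2)]
        · intro j hj
          simp [e, Set.disjoint_right.1 hst hj]
        · intro j hj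
          simp [e, hj]
    _ = extension f x * extension g x := by
        rw [extension, extension, Finset.sum_mul_sum, ← Finset.sum_product',
          Finset.univ_product_univ]
        exact Finset.sum_congr rfl fun p _ => by ring

theorem extension_prod {ι : Type*} (s : Finset ι) (f : ι → (Fin n → Bool) → ℤ)
    (t : ι → Set (Fin n)) (hf : ∀ i ∈ s, DependsOn (f i) (t i))
    (ht : (s : Set ι).PairwiseDisjoint t) :
    extension (fun θ => ∏ i ∈ s, f i θ) x = ∏ i ∈ s, extension (f i) x := by
  classical
  induction s using Finset.induction_on with
  | empty => simpa using extension_const x 1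
  | insert a s ha ih =>
    rw [Finset.prod_insert ha, ← ih (fun i hi => hf i (Finset.mem_insert_of_mem hi))
      (ht.subset (by simp)), ← extension_mul x (hf a (Finset.mem_insert_self a s))
      (t := ⋃ i ∈ s, t i)]
    · exact congrArg (extension · x) (funext fun θ => Finset.prod_insert ha)
    · intro θ η h
      exact Finset.prod_congr rfl fun i hi => hf i (Finset.mem_insert_of_mem hi) fun j hj =>
        h j (Set.mem_biUnion hi hj)
    · refine Set.disjoint_iUnion₂_right.2 fun i hi => ht (by simp) (by simp [hi]) ?_
      rintro rfl
      exact ha hi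

/-- The extension agrees with the function at valuations. -/
theorem extension_valuation (f : (Fin n → Bool) → ℤ) (θ : Fin n → Bool) :
    extension f (fun j => if θ j then 1 else 0) = f θ := by
  rw [extension, Finset.sum_eq_single θ]
  · have : valuationWeight (fun j => if θ j then 1 else 0) θ = 1 :=
      Finset.prod_eq_one fun j _ => by cases h : θ j <;> simp [h]
    rw [this, mul_one]
  · intro η _ h
    obtain ⟨j, hj⟩ := Function.ne_iff.1 h
    rw [valuationWeight, Finset.prod_eq_zero (Finset.mem_univ j), mul_zero]
    cases h₁ : η j <;> cases h₂ : θ j <;> simp_all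
  · simp

theorem extension_var (i : Fin n) : extension (fun θ => if θ i then 1 else 0) x = x i := by
  classical
  have h := Finset.prod_univ_sum (fun _ : Fin n => (Finset.univ : Finset Bool))
    (fun j b => (if j = i then (if b then 1 else 0) else 1) * if b then x j else 1 - x j)
  rw [Fintype.piFinset_univ] at h
  calc _ = ∑ θ : Fin n → Bool, ∏ j,
        ((if j = i then (if θ j then 1 else 0) else 1) * if θ j then x j else 1 - x j) := by
        refine Finset.sum_congr rfl fun θ _ => ?_
        rw [Finset.prod_mul_distrib, Finset.prod_ite_eq' Finset.univ i]
        simp [valuationWeight]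
    _ = x i := by
        rw [← h, Finset.prod_eq_single i]
        · simp
        · intro j _ hj
          simp [hj]
        · simp

/-- The coefficients of the extension as a multilinear polynomial. -/
def extensionCoeff (f : (Fin n → Bool) → ℤ) (T : Finset (Fin n)) : ℤ :=
  ∑ θ, f θ * ((∏ j ∈ T, if θ j then 1 else -1) * ∏ j ∈ Finset.univ \ T, if θ j then 0 else 1)

theorem extension_eq_sum_coeff (f : (Fin n → Bool) → ℤ) :
    extension f x = ∑ T, extensionCoeff f T * ∏ j ∈ T, x j := by
  simp only [extension, extensionCoeff, Finset.sum_mul]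
  rw [Finset.sum_comm]
  refine Finset.sum_congr rfl fun θ _ => ?_
  -- Each factor is affine in `x j`, with slope `1` or `-1`; expanding the product over subsets
  -- yields the coefficients.
  have : valuationWeight x θ =
      ∏ j, ((if θ j then 1 else -1) * x j + if θ j then 0 else 1) :=
    Finset.prod_congr rfl fun j _ => by cases θ j <;> simp; ring
  rw [this, Finset.prod_add, Finset.powerset_univ, Finset.mul_sum]
  refine Finset.sum_congr rfl fun T _ => ?_
  rw [Finset.prod_mul_distrib]
  ring

theorem abs_extensionCoeff_le {f : (Fin n → Bool) → ℤ} (hf : ∀ θ, |f θ| ≤ 1)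
    (T : Finset (Fin n)) : |extensionCoeff f T| ≤ 2 ^ n := by
  refine (Finset.abs_sum_le_sum_abs _ _).trans <|
    (Finset.sum_le_card_nsmul _ _ 1 fun θ _ => ?_).trans (by simp)
  rw [abs_mul, abs_mul, Finset.abs_prod, Finset.abs_prod]
  refine mul_le_one₀ (hf θ) (by positivity) (mul_le_one₀ ?_ (by positivity) ?_) <;>
    refine Finset.prod_le_one (fun _ _ => abs_nonneg _) fun j _ => ?_ <;>
    cases θ j <;> simp

end Extension

end ShapleyCircuits

namespace ShapleyCircuits

/-! ### Values of the gates of a circuit -/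

namespace Circuit

variable {n : ℕ} (C : Circuit n)

theorem gateValue_eq (θ : Fin n → Bool) (g : Fin C.size) :
    C.gateValue θ g = match C.label g with
      | .const b => b
      | .var x => θ x
      | .and => decide (∀ h ∈ C.inputs g, C.gateValue θ h = true)
      | .or => decide (∃ h ∈ C.inputs g, C.gateValue θ h = true)
      | .not => decide (∀ h ∈ C.inputs g, C.gateValue θ h = false) := by
  rw [gateValue, WellFounded.fix_eq]
  cases C.label g <;> simp only [exists_prop]

theorem varsBelow_subset {g h : Fin C.size} (hg : h ∈ C.inputs g) :
    C.varsBelow h ⊆ C.varsBelow g := fun _ ⟨k, hk, hx⟩ => ⟨k, hk.tail hg, hx⟩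

theorem dependsOn_gateValue (g : Fin C.size) :
    DependsOn (fun θ => C.gateValue θ g) (C.varsBelow g) := by
  induction g using C.acyclic.induction with
  | _ g ih =>
    intro θ η hη
    have hin : ∀ h ∈ C.inputs g, C.gateValue θ h = C.gateValue η h := fun h hg =>
      ih h hg fun x hx => hη x (C.varsBelow_subset hg hx)
    simp only [C.gateValue_eq θ g, C.gateValue_eq η g]
    cases hl : C.label g with
    | const b => rfl
    | var x => exact hη x ⟨g, .refl, hl⟩
    | and => simp +contextual [hin]
    | or =>
      exact decide_eq_decide.2 (exists_congr fun h => and_congr_right fun hg => by rw [hin h hg])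
    | not => simp +contextual [hin]

/-- The value of a gate as an integer. -/
def intValue (g : Fin C.size) (θ : Fin n → Bool) : ℤ :=
  if C.gateValue θ g then 1 else 0

/-- The multilinear extension of the value of a gate. -/
def gateExtension (wt : Fin n → ℤ) (g : Fin C.size) : ℤ :=
  extension (C.intValue g) wt

/-- For conjunctions, the inputs depend on disjoint sets of variables, so the extension is
multiplicative. For disjunctions, at most one input is true at a time, so the Boolean value is
already the sum of the input values. Constants, variables and negations are immediate. -/
theorem gateExtension_eq (hdet : C.Deterministic) (hdec : C.Decomposable) (wt : Fin n → ℤ)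
    (g : Fin C.size) :
    C.gateExtension wt g = match C.label g with
      | .const b => if b then 1 else 0
      | .var x => wt x
      | .and => ∏ h ∈ C.inputs g, C.gateExtension wt h
      | .or => ∑ h ∈ C.inputs g, C.gateExtension wt h
      | .not => 1 - ∑ h ∈ C.inputs g, C.gateExtension wt h := by
  have hfan := C.fanIn g
  cases hl : C.label g with
  | const b =>
    have : C.intValue g = fun _ => if b then 1 else 0 := by
      ext θ
      simp [intValue, C.gateValue_eq θ g, hl]
    simp [gateExtension, this, extension_const]
  | var x =>
    have : C.intValue g = fun θ => if θ x then 1 else 0 := by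
      ext θ
      simp [intValue, C.gateValue_eq θ g, hl]
    simp [gateExtension, this, extension_var]
  | and =>
    have : C.intValue g = fun θ => ∏ h ∈ C.inputs g, C.intValue h θ := by
      ext θ
      simp [intValue, C.gateValue_eq θ g, hl, Finset.prod_ite_zero]
    simp only [gateExtension, this]
    refine extension_prod wt _ _ C.varsBelow (fun h _ θ η hη => ?_)
      fun g₁ h₁ g₂ h₂ => hdec g hl g₁ h₁ g₂ h₂
    simp only [intValue]
    rw [show C.gateValue θ h = C.gateValue η h from C.dependsOn_gateValue h hη]
  | or =>
    have : C.intValue g = fun θ => ∑ h ∈ C.inputs g, C.intValue h θ := by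
      ext θ
      rw [intValue, C.gateValue_eq θ g, hl]
      by_cases hex : ∃ h ∈ C.inputs g, C.gateValue θ h = true
      · obtain ⟨h, hg, hv⟩ := hex
        rw [Finset.sum_eq_single_of_mem h hg, intValue, if_pos hv,
          if_pos (decide_eq_true ⟨h, hg, hv⟩)]
        intro k hk hkh
        rw [intValue, if_neg fun hv' => hdet g hl k hk h hg hkh ⟨θ, hv', hv⟩]
      · rw [if_neg (by simpa using hex), Finset.sum_eq_zero]
        intro h hg
        rw [intValue, if_neg fun hv => hex ⟨h, hg, hv⟩]
    simp only [gateExtension, this, extension_sum]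
  | not =>
    rw [hl] at hfan
    obtain ⟨h, hh⟩ := Finset.card_eq_one.1 hfan
    have : C.intValue g = fun θ => 1 - C.intValue h θ := by
      ext θ
      rw [intValue, C.gateValue_eq θ g, hl]
      cases hv : C.gateValue θ h <;> simp [hh, intValue, hv]
    simp only [gateExtension, this, hh, Finset.sum_singleton, extension_sub, extension_const]

theorem stepValue_eq (wt : Fin n → ℤ) (v : Fin C.size → ℤ) (g : Fin C.size) :
    C.stepValue wt v g = match C.label g with
      | .const b => if b then 1 else 0
      | .var x => wt x
      | .and => ∏ h ∈ C.inputs g, v h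
      | .or => ∑ h ∈ C.inputs g, v h
      | .not => 1 - ∑ h ∈ C.inputs g, v h := by
  have hfan := C.fanIn g
  have key : ∀ (o : ℤ → ℤ → ℤ) (b : ℤ),
      ((List.finRange C.size).map fun h => (decide (h ∈ C.inputs g), v h)).foldl
        (fun a p => if p.1 then o a p.2 else a) b =
      ((List.finRange C.size).filter fun h => h ∈ C.inputs g).foldl (fun a h => o a (v h)) b := by
    intro o b
    rw [List.foldl_map, List.foldl_filter]
  have hnd : ((List.finRange C.size).filter fun h => h ∈ C.inputs g).Nodup :=
    (List.nodup_finRange _).filter _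
  have htf : ((List.finRange C.size).filter fun h => h ∈ C.inputs g).toFinset = C.inputs g := by
    ext; simp
  rw [stepValue, Prog.gateValueOf, key]
  set l := (List.finRange C.size).filter fun h => h ∈ C.inputs g
  have hcard : l.length = (C.inputs g).card := by rw [← htf, List.toFinset_card_of_nodup hnd]
  rw [← htf]
  cases hl : C.label g with
  | const b =>
    rw [hl] at hfan
    rw [List.length_eq_zero_iff.1 (hcard.trans hfan)]; rfl
  | var x =>
    rw [hl] at hfan
    rw [List.length_eq_zero_iff.1 (hcard.trans hfan)]; rfl
  | and =>
    simp only [List.prod_toFinset _ hnd, List.prod_eq_foldl, List.foldl_map]; rfl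
  | or =>
    simp only [List.sum_toFinset _ hnd, List.sum_eq_foldl, List.foldl_map]; rfl
  | not =>
    rw [hl] at hfan
    obtain ⟨h, hh⟩ := List.length_eq_one_iff.1 (hcard.trans hfan)
    rw [hh]
    -- A negation starts from `2` and adds `-1 - v`, which gives `1 - v`.
    simp [Label.opSym, Label.start, Prog.gateOp]
    ring

/-- The gates that have a nonempty directed path to `g`. -/
noncomputable def ancestors (g : Fin C.size) : Finset (Fin C.size) := by
  classical
  exact Finset.univ.filter fun h => Relation.TransGen (fun a b => a ∈ C.inputs b) h g

theorem ancestors_ssubset {g h : Fin C.size} (hg : h ∈ C.inputs g) :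
    C.ancestors h ⊂ C.ancestors g := by
  classical
  have hirr : ¬ Relation.TransGen (fun a b => a ∈ C.inputs b) h h :=
    C.acyclic.transGen.irrefl.irrefl h
  refine Finset.ssubset_iff_of_subset ?_ |>.2 ⟨h, ?_, ?_⟩
  · intro k hk
    simp only [ancestors, Finset.mem_filter, Finset.mem_univ, true_and] at hk ⊢
    exact hk.tail hg
  · simpa [ancestors] using .single hg
  · simpa [ancestors] using hirr

/-- Inputs have strictly fewer ancestors, so they are already correct one round earlier. The initial
values `v` are irrelevant. -/
theorem iterate_stepValue_eq (hdet : C.Deterministic) (hdec : C.Decomposable) (wt : Fin n → ℤ)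
    (v : Fin C.size → ℤ) (t : ℕ) (g : Fin C.size) (ht : (C.ancestors g).card < t) :
    (C.stepValue wt)^[t] v g = C.gateExtension wt g := by
  induction t generalizing g with
  | zero => omega
  | succ t ih =>
    have hin : ∀ h ∈ C.inputs g, (C.stepValue wt)^[t] v h = C.gateExtension wt h := fun h hg =>
      ih h (by have := Finset.card_lt_card (C.ancestors_ssubset hg); omega)
    rw [Function.iterate_succ_apply', stepValue_eq, gateExtension_eq C hdet hdec,
      Finset.prod_congr rfl hin, Finset.sum_congr rfl hin]

theorem card_ancestors_lt (g : Fin C.size) : (C.ancestors g).card < C.size := by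
  have : C.ancestors g ⊂ Finset.univ := by
    refine (Finset.ssubset_univ_iff).2 fun h => ?_
    have hg : g ∈ C.ancestors g := h ▸ Finset.mem_univ g
    exact C.acyclic.transGen.irrefl.irrefl g (by simpa [ancestors] using hg)
  simpa using Finset.card_lt_card this

end Circuit

theorem Prog.outputValue_eq {n : ℕ} (C : Circuit n) (hdet : C.Deterministic)
    (hdec : C.Decomposable) (i : ℕ) :
    outputValue C i = extension (fun θ => if C.toFun θ then 1 else 0)
      fun x => if (x : ℕ) = i then 2 ^ (n * (2 * width n)) else 2 ^ width n :=
  C.iterate_stepValue_eq hdet hdec _ _ _ _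
    ((C.card_ancestors_lt _).trans_le (size_le_length_blocks C))

end ShapleyCircuits

namespace ShapleyCircuits

open scoped Nat

/-! ### Shapley values of multilinear polynomials -/

variable {n : ℕ}

theorem valueAt_eq_sum (F : (Fin n → Bool) → Bool) (S : Finset (Fin n)) :
    valueAt F S = ∑ T, (extensionCoeff (fun θ => if F θ then 1 else 0) T : ℚ) *
      if T ⊆ S then 1 else 0 := by
  have h := extension_eq_sum_coeff (fun j => if decide (j ∈ S) then 1 else 0)
    (fun θ => if F θ then 1 else 0)
  rw [extension_valuation] at h
  have hq := congrArg (Int.cast : ℤ → ℚ) h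
  push_cast at hq
  simp only [Finset.prod_ite_zero, Finset.prod_const_one, decide_eq_true_eq] at hq
  rw [valueAt, hq]
  exact Finset.sum_congr rfl fun T _ => by simp only [Finset.subset_iff]

/-- The orderings in which `i` is the last element of `T`. -/
def lastOrderings (T : Finset (Fin n)) (i : Fin n) : Finset (Equiv.Perm (Fin n)) :=
  {π | ∀ j ∈ T, π.symm j ≤ π.symm i}

/-- Exchanging `i` and `j` in an ordering is a bijection, since the swap maps `T` to itself. -/
theorem card_lastOrderings_eq {T : Finset (Fin n)} {i j : Fin n} (hi : i ∈ T) (hj : j ∈ T) :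
    (lastOrderings T i).card = (lastOrderings T j).card := by
  have hT : ∀ k ∈ T, Equiv.swap i j k ∈ T := fun k hk => by
    rw [Equiv.swap_apply_def]; split_ifs <;> assumption
  refine Finset.card_nbij' (fun π => π.trans (Equiv.swap i j)) (fun π => π.trans (Equiv.swap i j))
    ?_ ?_ ?_ ?_
  · intro π hπ
    simp only [lastOrderings, Finset.coe_filter, Finset.mem_univ, true_and, Set.mem_ofPred_eq]
      at hπ ⊢
    intro k hk
    simpa using hπ _ (hT k hk)
  · intro π hπ
    simp only [lastOrderings, Finset.coe_filter, Finset.mem_univ, true_and, Set.mem_ofPred_eq]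
      at hπ ⊢
    intro k hk
    simpa using hπ _ (hT k hk)
  · intro π _
    ext; simp
  · intro π _
    ext; simp

/-- Every ordering has exactly one last element of `T`, so the orderings split into `T.card` classes
of equal size. -/
theorem card_mul_card_lastOrderings {T : Finset (Fin n)} {i : Fin n} (hi : i ∈ T) :
    T.card * (lastOrderings T i).card = n ! := by
  classical
  have h : T.biUnion (lastOrderings T) = Finset.univ := by
    ext π
    obtain ⟨j, hj, hmax⟩ := T.exists_max_image π.symm ⟨i, hi⟩
    simp only [Finset.mem_biUnion, Finset.mem_univ, iff_true]
    exact ⟨j, hj, by simpa [lastOrderings] using hmax⟩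
  have hdisj : (T : Set (Fin n)).PairwiseDisjoint (lastOrderings T) := by
    intro j hj k hk hjk
    refine Finset.disjoint_left.2 fun π h₁ h₂ => hjk (π.symm.injective ?_)
    simp only [lastOrderings, Finset.mem_filter, Finset.mem_univ, true_and] at h₁ h₂
    exact le_antisymm (h₂ j hj) (h₁ k hk)
  calc T.card * (lastOrderings T i).card = ∑ j ∈ T, (lastOrderings T j).card := by
        rw [Finset.sum_congr rfl fun j hj => card_lastOrderings_eq hj hi, Finset.sum_const,
          smul_eq_mul]
    _ = n ! := by
        rw [← Finset.card_biUnion hdisj, h, Finset.card_univ, Fintype.card_perm, Fintype.card_fin]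

/-- The Shapley value, multiplied by `n !`, of the variable `i` for the monomial with the variables
in `T`. -/
def monomialShap (i : Fin n) (T : Finset (Fin n)) : ℕ :=
  if i ∈ T then n ! / T.card else 0

/-- Adding `i` completes `T` exactly when `i` is the last of its elements; if `i ∉ T` both
indicators agree. -/
theorem sum_subset_before (T : Finset (Fin n)) (i : Fin n) :
    ∑ π : Equiv.Perm (Fin n), ((if T ⊆ before π i ∪ {i} then 1 else 0) -
      (if T ⊆ before π i then 1 else 0) : ℚ) = monomialShap i T := by
  by_cases hi : i ∈ T
  · have h₁ : ∀ π : Equiv.Perm (Fin n), ¬ T ⊆ before π i := fun π h => by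
      simpa [before] using h hi
    have h₂ : ∀ π : Equiv.Perm (Fin n), T ⊆ before π i ∪ {i} ↔ π ∈ lastOrderings T i := by
      intro π
      simp only [lastOrderings, Finset.mem_filter, Finset.mem_univ, true_and, Finset.subset_iff,
        before, Finset.mem_union, Finset.mem_singleton]
      refine forall₂_congr fun j _ => ?_
      rw [le_iff_lt_or_eq, π.symm.injective.eq_iff]
    simp only [h₁, h₂, monomialShap, if_pos hi, if_false, sub_zero]
    rw [Finset.sum_boole, ← card_mul_card_lastOrderings hi,
      Nat.mul_div_cancel_left _ (Finset.card_pos.2 ⟨i, hi⟩)]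
    simp
  · have h : ∀ π : Equiv.Perm (Fin n), T ⊆ before π i ∪ {i} ↔ T ⊆ before π i := fun π => by
      rw [Finset.union_comm, ← Finset.insert_eq, Finset.subset_insert_iff_of_notMem hi]
    simp only [h, sub_self, Finset.sum_const_zero, monomialShap, if_neg hi, Nat.cast_zero]

/-- The Shapley value, multiplied by `n !`. -/
def shapNumerator (F : (Fin n → Bool) → Bool) (i : Fin n) : ℤ :=
  ∑ T, extensionCoeff (fun θ => if F θ then 1 else 0) T * monomialShap i T

theorem shapNumerator_div (F : (Fin n → Bool) → Bool) (i : Fin n) :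
    (shapNumerator F i : ℚ) / (n ! : ℕ) = shap F i := by
  rw [shap, one_div, ← div_eq_inv_mul]
  congr 1
  simp only [valueAt_eq_sum F, ← Finset.sum_sub_distrib, ← mul_sub]
  rw [Finset.sum_comm, shapNumerator]
  push_cast
  refine Finset.sum_congr rfl fun T _ => ?_
  rw [← Finset.mul_sum, sum_subset_before]

/-! ### Extraction of the Shapley value from the value of the extension -/

namespace Prog

/-- Unrolling the recursion. The coefficient `n ! / (j + 1)` is the Shapley weight of monomials of
degree `j + 1`, and its exponent complements that degree; the divisions are exact. -/
theorem weightSum_eq_sum (p : ℤ) (n : ℕ) :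
    weightSum p n = ∑ j ∈ Finset.range n, ((n ! / (j + 1) : ℕ) : ℤ) * p ^ (n - 1 - j) := by
  induction n with
  | zero => rfl
  | succ n ih =>
    rw [weightSum, ih, Finset.sum_range_succ, add_comm, Finset.mul_sum, Finset.mul_sum]
    congr 1
    · refine Finset.sum_congr rfl fun j hj => ?_
      have hj := Finset.mem_range.1 hj
      rw [Nat.factorial_succ, Nat.mul_div_assoc _ (Nat.dvd_factorial (by omega) (by omega)),
        show n + 1 - 1 - j = n - 1 - j + 1 by omega]
      push_cast
      ring
    · rw [Nat.factorial_succ, Nat.mul_div_cancel_left _ (Nat.succ_pos n)]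
      simp

/-- Being equal to `M * v` modulo `M * p` up to an error `b` is stable under sums, and under integer
multiples by `exists_abs_mul_sub_le`. This reduces the extraction of the digit to single monomials.
-/
theorem exists_abs_sum_sub_le {ι : Type*} (s : Finset ι) {M p : ℤ} {a v b : ι → ℤ}
    (h : ∀ i ∈ s, ∃ k, |a i - M * (v i + p * k)| ≤ b i) :
    ∃ k, |∑ i ∈ s, a i - M * (∑ i ∈ s, v i + p * k)| ≤ ∑ i ∈ s, b i := by
  choose! k hk using h
  refine ⟨∑ i ∈ s, k i, ?_⟩
  rw [Finset.mul_sum, ← Finset.sum_add_distrib, Finset.mul_sum, ← Finset.sum_sub_distrib]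
  exact (Finset.abs_sum_le_sum_abs _ _).trans (Finset.sum_le_sum hk)

theorem exists_abs_mul_sub_le {M p a v b : ℤ} (c : ℤ) (h : ∃ k, |a - M * (v + p * k)| ≤ b) :
    ∃ k, |c * a - M * (c * v + p * k)| ≤ |c| * b := by
  obtain ⟨k, hk⟩ := h
  refine ⟨c * k, ?_⟩
  rw [show c * a - M * (c * v + p * (c * k)) = c * (a - M * (v + p * k)) by ring, abs_mul]
  exact mul_le_mul_of_nonneg_left hk (abs_nonneg c)

theorem prod_weights (p : ℤ) (i : Fin n) (T : Finset (Fin n)) :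
    ∏ j ∈ T, (if (j : ℕ) = i then p ^ (2 * n) else p) =
      p ^ (if i ∈ T then 2 * n + (T.card - 1) else T.card) := by
  simp only [Fin.val_inj]
  split_ifs with h
  · rw [← Finset.mul_prod_erase T _ h, if_pos rfl, Finset.prod_congr rfl fun j hj =>
      if_neg (Finset.ne_of_mem_erase hj), Finset.prod_const, Finset.card_erase_of_mem h, pow_add]
  · rw [Finset.prod_congr rfl fun j hj => if_neg fun (e : j = i) => h (e ▸ hj), Finset.prod_const]

theorem exists_abs_monomial_sub_le {p : ℤ} (hp : 1 ≤ p) (i : Fin n) (T : Finset (Fin n)) :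
    ∃ k, |(∏ j ∈ T, (if (j : ℕ) = i then p ^ (2 * n) else p)) * weightSum p n -
      p ^ (3 * n - 1) * (monomialShap i T + p * k)| ≤ n * (n ! * p ^ (3 * n - 2)) := by
  have hn : 0 < n := i.pos
  have hp₀ : 0 ≤ p := zero_le_one.trans hp
  have hcard : T.card ≤ n := by simpa using T.card_le_univ
  rw [weightSum_eq_sum, Finset.mul_sum, prod_weights]
  have hshap : (monomialShap i T : ℤ) = ∑ j ∈ Finset.range n,
      if i ∈ T ∧ j + 1 = T.card then ((n ! / (j + 1) : ℕ) : ℤ) else 0 := by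
    by_cases h : i ∈ T
    · have hc : 0 < T.card := Finset.card_pos.2 ⟨i, h⟩
      rw [Finset.sum_eq_single (T.card - 1)]
      · simp [monomialShap, h, Nat.sub_add_cancel hc]
      · intro j _ hj
        rw [if_neg]
        omega
      · intro hj
        exact absurd (Finset.mem_range.2 (by omega)) hj
    · simp [monomialShap, h]
  have hb : (n : ℤ) * (n ! * p ^ (3 * n - 2)) =
      ∑ _j ∈ Finset.range n, (n ! : ℤ) * p ^ (3 * n - 2) := by simp
  rw [hshap, hb]
  refine exists_abs_sum_sub_le _ fun j hj => ?_
  have hj := Finset.mem_range.1 hj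
  set c : ℤ := ((n ! / (j + 1) : ℕ) : ℤ)
  have hc : |c| ≤ n ! := by
    rw [Nat.abs_cast]
    exact_mod_cast Nat.div_le_self _ _
  have hlow : ∀ e, e ≤ 3 * n - 2 →
      ∃ k, |c * p ^ e - p ^ (3 * n - 1) * (0 + p * k)| ≤ n ! * p ^ (3 * n - 2) := by
    intro e he
    refine ⟨0, ?_⟩
    rw [mul_zero, add_zero, mul_zero, sub_zero, abs_mul, abs_of_nonneg (pow_nonneg hp₀ e)]
    exact mul_le_mul hc (pow_le_pow_right₀ hp he) (by positivity) (by positivity)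
  have hpos : (0 : ℤ) ≤ n ! * p ^ (3 * n - 2) := by positivity
  rw [mul_left_comm, ← pow_add]
  by_cases h : i ∈ T
  · have hc : 0 < T.card := Finset.card_pos.2 ⟨i, h⟩
    rw [if_pos h]
    -- The exponent is `3n - 1 + |T| - (j + 1)`: a multiple of `p ^ (3n)` absorbed by `k`, the
    -- wanted place itself, or a low-order error.
    rcases lt_trichotomy (j + 1) T.card with hlt | heq | hgt
    · rw [if_neg (by omega)]
      refine ⟨c * p ^ (T.card - 1 - (j + 1)), ?_⟩
      rw [show 2 * n + (T.card - 1) + (n - 1 - j) =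
        3 * n - 1 + 1 + (T.card - 1 - (j + 1)) by omega, pow_add, pow_succ]
      refine le_of_eq_of_le ?_ hpos
      rw [abs_eq_zero]
      ring
    · rw [if_pos ⟨h, heq⟩]
      refine ⟨0, ?_⟩
      rw [show 2 * n + (T.card - 1) + (n - 1 - j) = 3 * n - 1 by omega, mul_zero, add_zero,
        mul_comm, sub_self, abs_zero]
      exact hpos
    · rw [if_neg (by omega)]
      exact hlow _ (by omega)
  · rw [if_neg h, if_neg (fun h' => h h'.1)]
    have : T.card < n := by simpa using Finset.card_lt_univ_of_notMem h
    exact hlow _ (by omega)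

theorem exists_abs_extension_sub_le {p : ℤ} (hp : 1 ≤ p) (F : (Fin n → Bool) → Bool) (i : Fin n) :
    ∃ k, |extension (fun θ => if F θ then 1 else 0)
        (fun j => if (j : ℕ) = i then p ^ (2 * n) else p) * weightSum p n -
      p ^ (3 * n - 1) * (shapNumerator F i + p * k)| ≤
      2 ^ n * (2 ^ n * (n * (n ! * p ^ (3 * n - 2)))) := by
  rw [extension_eq_sum_coeff, Finset.sum_mul, shapNumerator]
  obtain ⟨k, hk⟩ := exists_abs_sum_sub_le Finset.univ fun T _ =>
    exists_abs_mul_sub_le (extensionCoeff (fun θ => if F θ then 1 else 0) T)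
      (exists_abs_monomial_sub_le hp i T)
  refine ⟨k, ?_⟩
  simp only [mul_assoc]
  refine hk.trans <| (Finset.sum_le_card_nsmul _ _
    ((2 : ℤ) ^ n * (n * (n ! * p ^ (3 * n - 2)))) fun T _ => ?_).trans (by simp)
  refine mul_le_mul_of_nonneg_right (abs_extensionCoeff_le (fun θ => ?_) T) (by positivity)
  split_ifs <;> simp

theorem abs_shapNumerator_le (F : (Fin n → Bool) → Bool) (i : Fin n) :
    |shapNumerator F i| ≤ 2 ^ n * (2 ^ n * n !) := by
  refine (Finset.abs_sum_le_sum_abs _ _).trans <| (Finset.sum_le_card_nsmul _ _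
    ((2 : ℤ) ^ n * n !) fun T _ => ?_).trans (by simp)
  rw [abs_mul, Nat.abs_cast]
  refine mul_le_mul (abs_extensionCoeff_le (fun θ => ?_) T) ?_ (by positivity) (by positivity)
  · split_ifs <;> simp
  · rw [monomialShap]
    split_ifs
    · exact_mod_cast Nat.div_le_self _ _
    · positivity

/-- This fixes `width`. There are `2 ^ n` monomials with coefficients at most `2 ^ n`, each meeting
`n` weights of size at most `n !`. With `n < 2 ^ n` and `n ! ≤ 2 ^ (n * n)` the exponents add up to
`n * (n + 3) + 1`, the last `1` leaving room for rounding. -/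
theorem two_mul_lt_two_pow_width (n : ℕ) :
    2 * (2 ^ n * (2 ^ n * (n * n !))) < 2 ^ width n := by
  have h₁ : n < 2 ^ n := Nat.lt_two_pow_self
  have h₂ : n ! ≤ (2 ^ n) ^ n := (Nat.factorial_le_pow n).trans (Nat.pow_le_pow_left h₁.le n)
  calc 2 * (2 ^ n * (2 ^ n * (n * n !))) < 2 * (2 ^ n * (2 ^ n * (2 ^ n * (2 ^ n) ^ n))) := by
        gcongr ?_ * (?_ * (?_ * ?_))
        exact Nat.mul_lt_mul_of_lt_of_le h₁ h₂ (by positivity)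
    _ = 2 ^ width n := by
        rw [width, ← pow_mul]
        ring

theorem factorial_lt_two_pow_width (n : ℕ) : n ! < 2 ^ width n := by
  rcases Nat.eq_zero_or_pos n with rfl | hn
  · decide
  · refine lt_of_le_of_lt ?_ (two_mul_lt_two_pow_width n)
    calc n ! = 1 * (1 * (1 * (1 * n !))) := by ring
      _ ≤ _ := by gcongr <;> first | omega | exact Nat.one_le_two_pow

theorem two_mul_abs_shapNumerator_lt (F : (Fin n → Bool) → Bool) (i : Fin n) :
    2 * |shapNumerator F i| < 2 ^ width n := by
  have h := two_mul_lt_two_pow_width n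
  have hb := abs_shapNumerator_le F i
  have hn : (1 : ℤ) ≤ n := by exact_mod_cast i.pos
  zify at h
  refine lt_of_le_of_lt ?_ h
  refine mul_le_mul_of_nonneg_left (hb.trans ?_) (by norm_num)
  gcongr
  exact le_mul_of_one_le_left (by positivity) hn

theorem exists_two_mul_abs_extension_sub_lt (F : (Fin n → Bool) → Bool) (i : Fin n) :
    ∃ k, 2 * |extension (fun θ => if F θ then 1 else 0)
        (fun j => if (j : ℕ) = i then 2 ^ (n * (2 * width n)) else 2 ^ width n) *
        weightSum (2 ^ width n) n -
      2 ^ (wordLen n - width n) * (shapNumerator F i + 2 ^ width n * k)| <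
      2 ^ (wordLen n - width n) := by
  have hn : 0 < n := i.pos
  obtain ⟨k, hk⟩ := exists_abs_extension_sub_le (p := 2 ^ width n) (one_le_pow₀ (by norm_num)) F i
  have h₁ : ((2 : ℤ) ^ width n) ^ (3 * n - 1) = 2 ^ (wordLen n - width n) := by
    rw [← pow_mul, wordLen, Nat.mul_sub_one, mul_left_comm, mul_comm (width n), mul_left_comm]
  have h₂ : ((2 : ℤ) ^ width n) ^ (2 * n) = 2 ^ (n * (2 * width n)) := by
    rw [← pow_mul]
    congr 1
    ring
  have h := two_mul_lt_two_pow_width n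
  zify at h
  rw [← h₁, ← h₂]
  refine ⟨k, ?_⟩
  calc _ ≤ 2 * (2 ^ n * (2 ^ n * (n * (n ! * ((2 : ℤ) ^ width n) ^ (3 * n - 2))))) :=
        mul_le_mul_of_nonneg_left hk (by norm_num)
    _ = 2 * (2 ^ n * (2 ^ n * (n * n !))) * ((2 : ℤ) ^ width n) ^ (3 * n - 2) := by ring
    _ < 2 ^ width n * ((2 : ℤ) ^ width n) ^ (3 * n - 2) :=
        mul_lt_mul_of_pos_right h (by positivity)
    _ = _ := by
        rw [← pow_succ', show 3 * n - 2 + 1 = 3 * n - 1 by omega]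

end Prog

end ShapleyCircuits

/-! ### Polynomial register bound and conclusion. -/

namespace ShapleyCircuits

open scoped Nat

/-- A bound for the lengths of the registers. -/
noncomputable def spaceBound : Polynomial ℕ :=
  let w : Polynomial ℕ := .X * (.X + 3) + 1
  -- The summands bound the input, the words together with the unary counters, and the table with
  -- one word for each gate.
  .X + (.X * (3 * w) + w + .X + 2) + .X * (.X * (3 * w))

theorem exec_shapley_encode (G : DDCircuit) :
    Prog.shapley.exec (spaceBound.eval G.encode.length) (.init G.encode []) =
      some (.init [] (encodeFractions
        (List.ofFn fun i => (shapNumerator G.circuit.toFun i, G.numVars !)))) := by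
  obtain ⟨n, C, hdet, hdec⟩ := G
  have hl : C.encode.length = n + (C.blocks.length + 1) := by simp [C.encode_eq]
  have hs := Prog.size_le_length_blocks C
  have hn : n ≤ C.encode.length := by omega
  have hC : C.size ≤ C.encode.length := by omega
  simp only [DDCircuit.encode]
  generalize hm : C.encode.length = m at hn hC
  have hw : Prog.width n ≤ m * (m + 3) + 1 := by unfold Prog.width; gcongr
  have hL : Prog.wordLen n ≤ m * (3 * (m * (m + 3) + 1)) := by unfold Prog.wordLen; gcongr
  have hp : C.size * Prog.wordLen n ≤ m * (m * (3 * (m * (m + 3) + 1))) := by gcongr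
  have hN : spaceBound.eval m = m + (m * (3 * (m * (m + 3) + 1)) + (m * (m + 3) + 1) + m + 2) +
      m * (m * (3 * (m * (m + 3) + 1))) := by
    simp [spaceBound]
  rw [hN]
  refine Prog.exec_shapley C _ (Prog.two_mul_abs_shapNumerator_lt _) (fun i => ?_)
    (Prog.factorial_lt_two_pow_width n) ?_ ?_ ?_
  · rw [Prog.outputValue_eq C hdet hdec]
    exact Prog.exists_two_mul_abs_extension_sub_lt C.toFun i
  · omega
  · omega
  · omega

end ShapleyCircuits

theorem mainTheorem4 :
    ∃ f : ShapleyCircuits.DDCircuit → List (ℤ × ℕ),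
      (∀ G : ShapleyCircuits.DDCircuit,
        ShapleyCircuits.Represents (f G) (ShapleyCircuits.shapVector G.circuit.toFun)) ∧
      Nonempty (Turing.TM2ComputableInPolyTime
        ShapleyCircuits.DDCircuit.encode ShapleyCircuits.encodeFractions f) := by
  refine ⟨fun G => List.ofFn fun i =>
    (ShapleyCircuits.shapNumerator G.circuit.toFun i, G.numVars.factorial), fun G => ⟨?_, ?_⟩,
    ShapleyCircuits.Prog.nonempty_tm2ComputableInPolyTime _ _ ShapleyCircuits.exec_shapley_encode⟩
  · intro q hq
    obtain ⟨i, rfl⟩ := (List.mem_ofFn' _ _).1 hq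
    exact Nat.factorial_ne_zero _
  · rw [List.map_ofFn, ShapleyCircuits.shapVector]
    exact congrArg List.ofFn (funext fun i =>
      ShapleyCircuits.shapNumerator_div G.circuit.toFun i)
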